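/- \textbf{Codazzi and Gauss equations.} Let $M$ be a connected smooth $n$-manifold and $F_0:M\hookrightarrow\mathbb{S}^{n+1}\subset\mathbb{R}^{n+2}$ a smooth embedding with unit normal field $\nu_0$ whose principal curvatures are constant (an isoparametric hypersurface). For $t\in\mathbb{R}$ put $F_t=\cos(t)F_0+\sin(t)\nu_0$ and $\nu_t=-\sin(t)F_0+\cos(t)\nu_0$, and let $t$ be regular, i.e. $F_t$ is an immersion ($t=0$ is regular). Let $g_t$ be the metric induced on $M$ by $F_t$, $\nabla^t$ its Levi-Civita connection, and $A_t$ the shape operator, defined by $d\nu_t=-dF_t\,A_t$. Put $$\alpha(X,Y,Z)=g_t\big((\nabla^t_XA_t)Y,Z\big).$$ Let $\hat F_0=\tfrac1{\sqrt2}(F_0+i\nu_0):M\to\mathbb{C}^{n+2}$; its projectivization $[\hat F_0]$ is a Lagrangian immersion into the complex quadric $Q_n\subset\mathbb{C}P^{n+1}$, and the metric it induces on $M$ is $\hat g=\mathrm{Re}\,(\hat F_0^{*}\langle\cdot,\cdot\rangle_h)$, where $\langle\cdot,\cdot\rangle_h$ is the standard Hermitian inner product. Let $\nabla$ be the Levi-Civita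 connection of $\hat g$ and $$R(X,Y,Z,W)=\hat g\big(\nabla_X\nabla_YZ-\nabla_Y\nabla_XZ-\nabla_{[X,Y]}Z,\,W\big)$$ its curvature tensor. Let $B_0=(A_0+i\,\mathrm{Id})(A_0-i\,\mathrm{Id})^{-1}$ on $TM\otimes\mathbb{C}$, extend $\hat g$ complex bilinearly, and set $$b(X,Y)=\hat g(B_0X,Y),\qquad \overline b(X,Y)=\hat g(B_0^{-1}X,Y),\qquad T(X,Y,Z,W)=\mathrm{Im}\big(b(X,Y)\,\overline b(Z,W)\big).$$ For symmetric $(2,0)$-tensors $h_1,h_2$ let $$(h_1\odot h_2)(X,Y,Z,W)=\tfrac12\big(h_1(X,W)h_2(Y,Z)+h_2(X,W)h_1(Y,Z)-h_1(X,Z)h_2(Y,W)-h_2(X,Z)h_1(Y,W)\big)$$ be the Kulkarni--Nomizu product, and let $$(\alpha\odot_{\hat g}\alpha)(X,Y,Z,W)=\mathrm{tr}_{\hat g}\big\{\alpha(X,W,\cdot)\,\alpha(Y,Z,\cdot)-\alpha(X,Z,\cdot)\,\alpha(Y,W,\cdot)\big\}.$$ Then for all smooth vector fields $X,Y,Z,W$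 on $M$ the Codazzi equation $$(\nabla_X\alpha)(Y,Z,W)-(\nabla_Y\alpha)(X,Z,W)=2\big[T(X,Z,Y,W)+T(X,W,Y,Z)\big]$$ and the Gauss equation $$R(X,Y,Z,W)=\big(\hat g\odot\hat g+b\odot\overline b+\tfrac14\,\alpha\odot_{\hat g}\alpha\big)(X,Y,Z,W)$$ hold. -/

import Mathlib

open scoped Manifold ContDiff TensorProduct

noncomputable section

namespace Isoparametric

/-! ### Vector fields, Levi-Civita connection and curvature -/

section Riemannian

variable {n : ℕ} {M : Type*} [TopologicalSpace M] [ChartedSpace (EuclideanSpace ℝ (Fin n)) M]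

variable [IsManifold (𝓡 n) ∞ M]

/-- Smoothness of a vector field on `M`, i.e. `X ∈ Γ(TM)`. -/
def IsSmoothField (X : Π p : M, TangentSpace (𝓡 n) p) : Prop :=
  ContMDiff (𝓡 n) (𝓡 n).tangent ∞ (fun p => (⟨p, X p⟩ : TangentBundle (𝓡 n) M))

/-- The derivative `X f` of a real function `f` along a vector field `X`. -/
def fieldDeriv (X : Π p : M, TangentSpace (𝓡 n) p) (f : M → ℝ) (p : M) : ℝ :=
  mvfderiv (𝓡 n) f p (X p)

/-- The right-hand side of the Koszul formula of the metric `g`: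
`½ (X g(Y,Z) + Y g(X,Z) - Z g(X,Y) + g([X,Y],Z) - g([X,Z],Y) - g([Y,Z],X))`. -/
def koszul (g : Π p : M, LinearMap.BilinForm ℝ (TangentSpace (𝓡 n) p))
    (X Y Z : Π p : M, TangentSpace (𝓡 n) p) (p : M) : ℝ :=
  (1 / 2) * (fieldDeriv X (fun q => g q (Y q) (Z q)) p
    + fieldDeriv Y (fun q => g q (X q) (Z q)) p
    - fieldDeriv Z (fun q => g q (X q) (Y q)) p
    + g p (VectorField.mlieBracket (𝓡 n) X Y p) (Z p)
    - g p (VectorField.mlieBracket (𝓡 n) X Z p) (Y p)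
    - g p (VectorField.mlieBracket (𝓡 n) Y Z p) (X p))

open Classical in
/-- The Levi-Civita connection `∇_X Y` of the metric `g`: at each point, the tangent vector
determined by the Koszul formula `g(∇_X Y, Z) = koszul g X Y Z` for all smooth `Z`. -/
def leviCivita (g : Π p : M, LinearMap.BilinForm ℝ (TangentSpace (𝓡 n) p))
    (X Y : Π p : M, TangentSpace (𝓡 n) p) (p : M) : TangentSpace (𝓡 n) p :=
  if h : ∃ v : TangentSpace (𝓡 n) p, ∀ Z : (Π q : M, TangentSpace (𝓡 n) q),
      IsSmoothField Z → g p v (Z p) = koszul g X Y Z p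
  then h.choose else 0

/-- The Riemann curvature tensor
`R(X,Y,Z,W) = g(∇_X ∇_Y Z - ∇_Y ∇_X Z - ∇_{[X,Y]} Z, W)`. -/
def riemann (g : Π p : M, LinearMap.BilinForm ℝ (TangentSpace (𝓡 n) p))
    (X Y Z W : Π p : M, TangentSpace (𝓡 n) p) (p : M) : ℝ :=
  g p (leviCivita g X (leviCivita g Y Z) p - leviCivita g Y (leviCivita g X Z) p
    - leviCivita g (VectorField.mlieBracket (𝓡 n) X Y) Z p) (W p)

/-- The covariant derivative `(∇_X τ)(Y,Z,W)` of a `(3,0)`-tensor `τ` (acting on vector fields)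
with respect to the Levi-Civita connection of `g`. -/
def covDerivTensor (g : Π p : M, LinearMap.BilinForm ℝ (TangentSpace (𝓡 n) p))
    (τ : (Π p : M, TangentSpace (𝓡 n) p) → (Π p : M, TangentSpace (𝓡 n) p) →
      (Π p : M, TangentSpace (𝓡 n) p) → M → ℝ)
    (X Y Z W : Π p : M, TangentSpace (𝓡 n) p) (p : M) : ℝ :=
  fieldDeriv X (τ Y Z W) p
    - τ (leviCivita g X Y) Z W p - τ Y (leviCivita g X Z) W p - τ Y Z (leviCivita g X W) p

end Riemannian

/-! ### Linear algebra: metric traces and the Kulkarni-Nomizu product -/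

open Classical in
/-- The trace `tr_g β = ∑ᵢ β(eᵢ,eᵢ)` over a `g`-orthonormal basis `e` of the `n`-dimensional
space `V`. -/
def metricTrace {V : Type*} (n : ℕ) (g β : V → V → ℝ) : ℝ :=
  if h : ∃ e : Fin n → V, ∀ i j, g (e i) (e j) = if i = j then 1 else 0
  then ∑ i, β (h.choose i) (h.choose i) else 0

/-- The Kulkarni-Nomizu product of two symmetric `(2,0)`-tensors (normalised with the
factor `1/2`). -/
def kulkarniNomizu {V : Type*} (h₁ h₂ : V → V → ℂ) (x y z w : V) : ℂ :=
  (1 / 2) * (h₁ x w * h₂ y z + h₂ x w * h₁ y z - h₁ x z * h₂ y w - h₂ x z * h₁ y w)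

/-! ### Hypersurfaces of the sphere -/

section Hypersurface

variable {n : ℕ} {M : Type*} [TopologicalSpace M] [ChartedSpace (EuclideanSpace ℝ (Fin n)) M]
  [IsManifold (𝓡 n) ∞ M]

/-- The metric `⟨df ·, df ·⟩` induced on `M` by a map `f` into Euclidean space
(the first fundamental form of `f`). -/
def inducedMetric (f : M → EuclideanSpace ℝ (Fin (n + 2))) (p : M) :
    LinearMap.BilinForm ℝ (TangentSpace (𝓡 n) p) :=
  LinearMap.mk₂ ℝ (fun u v => inner ℝ (mvfderiv (𝓡 n) f p u) (mvfderiv (𝓡 n) f p v))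
    (fun u v w => by simp [inner_add_left]) (fun c u v => by simp [inner_smul_left])
    (fun u v w => by simp [inner_add_right]) (fun c u v => by simp [inner_smul_right])

open Classical in
/-- The shape operator `A` of `f` with respect to the unit normal field `ν`: the endomorphism of
`T_p M` determined by the Weingarten equation `dν = -df ∘ A`. -/
def shapeOperator (f ν : M → EuclideanSpace ℝ (Fin (n + 2))) (p : M) :
    Module.End ℝ (TangentSpace (𝓡 n) p) :=
  if h : ∃ A : Module.End ℝ (TangentSpace (𝓡 n) p),
      ∀ u, mvfderiv (𝓡 n) ν p u = -mvfderiv (𝓡 n) f p (A u)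
  then h.choose else 0

/-- `F : M → 𝕊ⁿ⁺¹` together with the unit normal vector field `ν` is an isoparametric
hypersurface: `F` is a smooth embedding, `ν` is a smooth unit vector field along `F` tangent to
the sphere and normal to `F`, and the principal curvatures (with their multiplicities) do not
depend on the point. -/
structure IsIsoparametric (F : M → Metric.sphere (0 : EuclideanSpace ℝ (Fin (n + 2))) 1)
    (ν : M → EuclideanSpace ℝ (Fin (n + 2))) : Prop where
  smooth : ContMDiff (𝓡 n) (𝓡 (n + 1)) ∞ F
  immersion : ∀ p, Function.Injective (mfderiv (𝓡 n) (𝓡 (n + 1)) F p)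
  embedding : Topology.IsEmbedding F
  normal_smooth : ContMDiff (𝓡 n) 𝓘(ℝ, EuclideanSpace ℝ (Fin (n + 2))) ∞ ν
  normal_unit : ∀ p, ‖ν p‖ = 1
  normal_tangent : ∀ p, inner ℝ (F p : EuclideanSpace ℝ (Fin (n + 2))) (ν p) = 0
  normal_orthogonal : ∀ p (u : TangentSpace (𝓡 n) p),
    inner ℝ (mvfderiv (𝓡 n) (fun q => (F q : EuclideanSpace ℝ (Fin (n + 2)))) p u) (ν p) = 0
  const_principal : ∀ p q : M, ∀ κ : ℝ,
    Module.finrank ℝ (Module.End.eigenspace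
        (shapeOperator (fun q => (F q : EuclideanSpace ℝ (Fin (n + 2)))) ν p) κ)
      = Module.finrank ℝ (Module.End.eigenspace
        (shapeOperator (fun q => (F q : EuclideanSpace ℝ (Fin (n + 2)))) ν q) κ)

variable (F : M → Metric.sphere (0 : EuclideanSpace ℝ (Fin (n + 2))) 1)
  (ν : M → EuclideanSpace ℝ (Fin (n + 2)))

/-- The parallel surface `F_t = cos t · F + sin t · ν`, as a map into Euclidean space. -/
def parallel (t : ℝ) (p : M) : EuclideanSpace ℝ (Fin (n + 2)) :=
  Real.cos t • (F p : EuclideanSpace ℝ (Fin (n + 2))) + Real.sin t • ν p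

/-- The unit normal `ν_t = -sin t · F + cos t · ν` of the parallel surface `F_t`. -/
def parallelNormal (t : ℝ) (p : M) : EuclideanSpace ℝ (Fin (n + 2)) :=
  -Real.sin t • (F p : EuclideanSpace ℝ (Fin (n + 2))) + Real.cos t • ν p

/-- The parameter `t` is regular (no focal point is hit): `F_t` is an immersion. -/
def IsRegular (t : ℝ) : Prop :=
  ∀ p, Function.Injective (mvfderiv (𝓡 n) (parallel F ν t) p)

/-- The metric `g_t` induced on `M` by `F_t`. -/
def parallelMetric (t : ℝ) (p : M) : LinearMap.BilinForm ℝ (TangentSpace (𝓡 n) p) :=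
  inducedMetric (parallel F ν t) p

/-- The shape operator `A_t` of `F_t` with respect to `ν_t`. -/
def parallelShape (t : ℝ) (p : M) : Module.End ℝ (TangentSpace (𝓡 n) p) :=
  shapeOperator (parallel F ν t) (parallelNormal F ν t) p

/-- The lift `F̂_t = (F_t + i ν_t)/√2` to the Stiefel manifold in the unit sphere of `ℂⁿ⁺²`;
its class `[F̂_t] = [F̂_0]` in the complex quadric is the Lagrangian immersion. -/
def lift (t : ℝ) (p : M) : EuclideanSpace ℂ (Fin (n + 2)) :=
  WithLp.toLp 2 fun k =>
    ((1 / Real.sqrt 2 : ℝ) : ℂ) *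
      ((parallel F ν t p k : ℂ) + Complex.I * (parallelNormal F ν t p k : ℂ))

/-- The metric `ĝ = Re (F̂_0^* ⟨·,·⟩_h)` of the Lagrangian submanifold. -/
def lagrangianMetric (p : M) : LinearMap.BilinForm ℝ (TangentSpace (𝓡 n) p) :=
  LinearMap.mk₂ ℝ
    (fun u v => (inner ℂ (mvfderiv (𝓡 n) (lift F ν 0) p u)
      (mvfderiv (𝓡 n) (lift F ν 0) p v)).re)
    (fun u v w => by simp)
    (fun c u v => by simp [inner_smul_left_eq_smul])
    (fun u v w => by simp)
    (fun c u v => by simp [inner_smul_right_eq_smul])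

/-- `α^t(X,Y,·)` at `p` as a function of a tangent vector `z` at `p`:
`g_t((∇^t_X A_t) Y, z)` where `(∇^t_X A_t) Y = ∇^t_X (A_t Y) - A_t (∇^t_X Y)` and `∇^t` is the
Levi-Civita connection of `g_t`. -/
def alphaForm (t : ℝ) (X Y : Π p : M, TangentSpace (𝓡 n) p) (p : M)
    (z : TangentSpace (𝓡 n) p) : ℝ :=
  parallelMetric F ν t p
    (leviCivita (parallelMetric F ν t) X (fun q => parallelShape F ν t q (Y q)) p
      - parallelShape F ν t p (leviCivita (parallelMetric F ν t) X Y p)) z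

/-- The tensor `α^t(X,Y,Z) = g_t((∇^t_X A_t) Y, Z)`. -/
def alpha (t : ℝ) (X Y Z : Π p : M, TangentSpace (𝓡 n) p) (p : M) : ℝ :=
  alphaForm F ν t X Y p (Z p)

/-- `(α ⊙_ĝ α)(X,Y,Z,W) = tr_ĝ {α(X,W,·) α(Y,Z,·) - α(X,Z,·) α(Y,W,·)}`. -/
def alphaKulkarniNomizu (t : ℝ) (X Y Z W : Π p : M, TangentSpace (𝓡 n) p) (p : M) : ℝ :=
  metricTrace n (fun u v => lagrangianMetric F ν p u v) fun u v =>
    alphaForm F ν t X W p u * alphaForm F ν t Y Z p v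
      - alphaForm F ν t X Z p u * alphaForm F ν t Y W p v

/-- The operator `B_0 = (A_0 + i)(A_0 - i)⁻¹` on the complexified tangent space. -/
def opB (p : M) : Module.End ℂ (ℂ ⊗[ℝ] TangentSpace (𝓡 n) p) :=
  ((parallelShape F ν 0 p).baseChange ℂ + Complex.I • 1) *
    Ring.inverse ((parallelShape F ν 0 p).baseChange ℂ - Complex.I • 1)

/-- `b(x,y) = ĝ(B_0 x, y)`, with `ĝ` extended complex bilinearly. -/
def formB (p : M) (x y : TangentSpace (𝓡 n) p) : ℂ :=
  (lagrangianMetric F ν p).baseChange ℂ (opB F ν p (1 ⊗ₜ x)) (1 ⊗ₜ y)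

/-- `b̄(x,y) = ĝ(B_0⁻¹ x, y)`, with `ĝ` extended complex bilinearly. -/
def formBbar (p : M) (x y : TangentSpace (𝓡 n) p) : ℂ :=
  (lagrangianMetric F ν p).baseChange ℂ (Ring.inverse (opB F ν p) (1 ⊗ₜ x)) (1 ⊗ₜ y)

/-- `T(x,y,z,w) = Im (ĝ(B_0 x, y) ĝ(B_0⁻¹ z, w))`. -/
def tensorT (p : M) (x y z w : TangentSpace (𝓡 n) p) : ℝ :=
  (formB F ν p x y * formBbar F ν p z w).im

end Hypersurface

end Isoparametric

end

/-! The computation takes place in the flat space `V × V`, a model of `ℂ^(n+2)`, rather than in the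
quadric. Put `P = F_0` and `N = ν_0`. The metric `ĝ` is induced by the immersion `(P, N)/√2`, so its
Levi-Civita connection is the tangential part of the flat second derivative, and its curvature is
given by the classical Gauss formula for an immersion into an inner product space.

For a `ĝ`-orthonormal frame `e`, the vectors `(dP e, dN e)/√2`, their rotations `(dN e, -dP e)/√2`
and `(P,0), (N,0), (0,P), (0,N)` form an orthonormal basis of `V × V`
(`sum_inner_lagrangian_frame`). Tangent and rotated vectors are orthogonal because `⟨dP u, dN v⟩` is
symmetric, which is the Lagrangian condition. The second fundamental form therefore has two parts.
The rotated part is half the cubic form `Ω(D_X D_Y (P,N), d(P,N) Z)`. The part along the last four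
vectors involves only products of first derivatives.

The cubic form is `α`, for every regular `t`: passing from `(F_0, ν_0)` to `(F_t, ν_t)` multiplies
`P + iN` by `e^(-it)`, which preserves `Ω` (`cubicForm_rotate`), and for one hypersurface the
Weingarten equation identifies it with `g((∇_X A)Y, Z)` (`metric_covDeriv_shapeOperator`).

On the algebraic side, `(A+i)(A-i)⁻¹ = (A+i)²(A²+1)⁻¹` and `ĝ = ½ g((A²+1)·,·)` give `b = ½
g((A+i)²·,·)`, so `b` and `b̄` are polynomial in the first-derivative products
(`formB_formBbar_eq`). The Gauss equation pairs second fundamental forms: the rotated part gives `¼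
α ⊙ α`, the other four directions give `ĝ ⊙ ĝ + b ⊙ b̄`. For Codazzi the derivative of the cubic
form is antisymmetrised: third derivatives cancel because the connection is torsion-free, the
connection terms cancel, and the four directions leave `T`. -/

noncomputable section

namespace Isoparametric

/-! ### Derivatives of vector-valued functions along vector fields. -/

section Calculus

variable {n : ℕ} {M : Type*} [TopologicalSpace M] [ChartedSpace (EuclideanSpace ℝ (Fin n)) M]
  {E E' : Type*} [NormedAddCommGroup E] [NormedSpace ℝ E] [NormedAddCommGroup E']
  [NormedSpace ℝ E']

/-- The derivative `D_X c` of a vector-valued function `c` along a vector field `X`. -/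
def dirDeriv (X : Π p : M, TangentSpace (𝓡 n) p) (c : M → E) (p : M) : E :=
  mvfderiv (𝓡 n) c p (X p)

/-- Smoothness of a vector-valued function on `M`. -/
abbrev SmoothMap (c : M → E) : Prop := ContMDiff (𝓡 n) 𝓘(ℝ, E) ∞ c

theorem SmoothMap.mdifferentiableAt {c : M → E} (hc : SmoothMap (n := n) c) (p : M) :
    MDifferentiableAt (𝓡 n) 𝓘(ℝ, E) c p :=
  (hc p).mdifferentiableAt (by simp)

theorem mvfderiv_comp_of_hasFDerivAt {c : M → E} {p : M}
    (hc : MDifferentiableAt (𝓡 n) 𝓘(ℝ, E) c p) {G : E → E'} {G' : E →L[ℝ] E'}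
    (hG : HasFDerivAt G G' (c p)) (u : TangentSpace (𝓡 n) p) :
    mvfderiv (𝓡 n) (fun q => G (c q)) p u = G' (mvfderiv (𝓡 n) c p u) := by
  have h := (HasMFDerivAt.comp p hG.hasMFDerivAt hc.hasMFDerivAt).mfderiv
  exact congrArg (fun T : EuclideanSpace ℝ (Fin n) →L[ℝ] E' => T u) h

theorem mvfderiv_clm_comp {c : M → E} (hc : SmoothMap (n := n) c) (L : E →L[ℝ] E') (p : M)
    (u : TangentSpace (𝓡 n) p) :
    mvfderiv (𝓡 n) (fun q => L (c q)) p u = L (mvfderiv (𝓡 n) c p u) :=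
  mvfderiv_comp_of_hasFDerivAt (hc.mdifferentiableAt p) L.hasFDerivAt u

theorem mvfderiv_prodMk {c : M → E} {d : M → E'} (hc : SmoothMap (n := n) c)
    (hd : SmoothMap (n := n) d) (p : M) (u : TangentSpace (𝓡 n) p) :
    mvfderiv (𝓡 n) (fun q => (c q, d q)) p u
      = (mvfderiv (𝓡 n) c p u, mvfderiv (𝓡 n) d p u) := by
  have h1 := (hc.mdifferentiableAt p).hasMFDerivAt
  have h2 := (hd.mdifferentiableAt p).hasMFDerivAt
  have h := (show HasMFDerivAt (𝓡 n) 𝓘(ℝ, E × E') (fun q => (c q, d q)) p _ from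
    ⟨h1.1.prodMk h2.1, HasFDerivWithinAt.prodMk h1.2 h2.2⟩).mfderiv
  exact congrArg (fun T : EuclideanSpace ℝ (Fin n) →L[ℝ] E × E' => T u) h

theorem SmoothMap.inner {V : Type*} [NormedAddCommGroup V] [InnerProductSpace ℝ V]
    {c d : M → V} (hc : SmoothMap (n := n) c) (hd : SmoothMap (n := n) d) :
    SmoothMap (n := n) (fun q => inner ℝ (c q) (d q)) :=
  (contDiff_inner (𝕜 := ℝ) (E := V) (n := ∞)).contMDiff.comp (hc.prodMk_space hd)

theorem mvfderiv_inner {V : Type*} [NormedAddCommGroup V] [InnerProductSpace ℝ V]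
    {c d : M → V} (hc : SmoothMap (n := n) c) (hd : SmoothMap (n := n) d) (p : M)
    (u : TangentSpace (𝓡 n) p) :
    mvfderiv (𝓡 n) (fun q => inner ℝ (c q) (d q)) p u
      = inner ℝ (mvfderiv (𝓡 n) c p u) (d p) + inner ℝ (c p) (mvfderiv (𝓡 n) d p u) := by
  have h := mvfderiv_comp_of_hasFDerivAt
    ((SmoothMap.mdifferentiableAt (hc.prodMk_space hd)) p)
    ((contDiff_inner (𝕜 := ℝ) (E := V) (n := 1)).differentiable (by simp) (c p, d p)).hasFDerivAt u
  rw [mvfderiv_prodMk hc hd] at h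
  rw [h, fderiv_inner_apply ℝ (by fun_prop) (by fun_prop)]
  rw [fderiv_fst, fderiv_snd, add_comm]
  rfl

theorem mvfderiv_congr {c d : M → E} {p : M} (h : c =ᶠ[nhds p] d) (u : TangentSpace (𝓡 n) p) :
    mvfderiv (𝓡 n) c p u = mvfderiv (𝓡 n) d p u :=
  congrArg (fun T : EuclideanSpace ℝ (Fin n) →L[ℝ] E => T u) h.mfderiv_eq

variable [IsManifold (𝓡 n) ∞ M]

theorem contMDiff_dirDeriv {X : Π p : M, TangentSpace (𝓡 n) p} (hX : IsSmoothField X)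
    {c : M → E} (hc : SmoothMap (n := n) c) : SmoothMap (n := n) (dirDeriv X c) := by
  have h1 := (ContMDiff.contMDiff_tangentMap (m := ∞) hc (by simp)).comp hX
  exact (contMDiff_snd_tangentBundle_modelSpace E 𝓘(ℝ, E)).comp h1


theorem mvfderiv_extChartAt_apply_field (X : Π p : M, TangentSpace (𝓡 n) p) (p : M) :
    ∀ᶠ q in nhds p, mvfderiv (𝓡 n) (extChartAt (𝓡 n) p) q (X q)
      = VectorField.mpullbackWithin 𝓘(ℝ, EuclideanSpace ℝ (Fin n)) (𝓡 n)
          (extChartAt (𝓡 n) p).symm X (Set.range (𝓡 n)) (extChartAt (𝓡 n) p q) := by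
  have h := VectorField.eventuallyEq_mpullback_mpullbackWithin_extChartAt (I := 𝓡 n)
    (s := Set.univ) (x := p) X
  rw [nhdsWithin_univ] at h
  filter_upwards [h, extChartAt_source_mem_nhds (I := 𝓡 n) p] with q hq hs
  rw [hq, VectorField.mpullback_apply]
  exact (isInvertible_mfderiv_extChartAt hs).self_apply_inverse _

theorem contDiffOn_comp_extChartAt_symm {c : M → E} (hc : SmoothMap (n := n) c) (p : M) :
    ContDiffOn ℝ ∞ (c ∘ (extChartAt (𝓡 n) p).symm) (extChartAt (𝓡 n) p).target :=
  (hc.comp_contMDiffOn (contMDiffOn_extChartAt_symm p)).contDiffOn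

theorem mvfderiv_eq_fderiv_chart {c : M → E} (hc : SmoothMap (n := n) c) (p : M) :
    ∀ᶠ q in nhds p, ∀ u : TangentSpace (𝓡 n) q, mvfderiv (𝓡 n) c q u
      = fderiv ℝ (c ∘ (extChartAt (𝓡 n) p).symm) (extChartAt (𝓡 n) p q)
          (mvfderiv (𝓡 n) (extChartAt (𝓡 n) p) q u) := by
  filter_upwards [extChartAt_source_mem_nhds (I := 𝓡 n) p] with q hs u
  have hd : DifferentiableAt ℝ (c ∘ (extChartAt (𝓡 n) p).symm) (extChartAt (𝓡 n) p q) :=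
    ((contDiffOn_comp_extChartAt_symm hc p).contDiffAt
      ((isOpen_extChartAt_target p).mem_nhds ((extChartAt (𝓡 n) p).map_source hs))).differentiableAt
      (by simp)
  have he : MDifferentiableAt (𝓡 n) 𝓘(ℝ, EuclideanSpace ℝ (Fin n)) (extChartAt (𝓡 n) p) q :=
    mdifferentiableAt_extChartAt (by simpa using hs)
  rw [← mvfderiv_comp_of_hasFDerivAt he hd.hasFDerivAt]
  refine mvfderiv_congr ?_ u
  filter_upwards [(isOpen_extChartAt_source p).mem_nhds hs] with r hr
  exact congrArg c ((extChartAt (𝓡 n) p).left_inv hr).symm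

/-- The manifold bracket is by definition the flat bracket of the fields read in the chart at `p`,
so the claim reduces to symmetry of the second derivative of `c` in that chart. -/
theorem dirDeriv_mlieBracket {X Y : Π p : M, TangentSpace (𝓡 n) p} (hX : IsSmoothField X)
    (hY : IsSmoothField Y) {c : M → E} (hc : SmoothMap (n := n) c) (p : M) :
    dirDeriv (VectorField.mlieBracket (𝓡 n) X Y) c p
      = dirDeriv X (dirDeriv Y c) p - dirDeriv Y (dirDeriv X c) p := by
  set φ := extChartAt (𝓡 n) p
  set c' : EuclideanSpace ℝ (Fin n) → E := c ∘ φ.symm with hc'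
  have hpt : φ.target ∈ nhds (φ p) := extChartAt_target_mem_nhds p
  have hcd : ContDiffAt ℝ ∞ c' (φ p) := (contDiffOn_comp_extChartAt_symm hc p).contDiffAt hpt
  have hchart := mvfderiv_eq_fderiv_chart hc p
  have hφ : MDifferentiableAt (𝓡 n) 𝓘(ℝ, EuclideanSpace ℝ (Fin n)) φ p :=
    mdifferentiableAt_extChartAt (mem_chart_source _ p)
  let pull (V : Π p : M, TangentSpace (𝓡 n) p) : EuclideanSpace ℝ (Fin n) →
      EuclideanSpace ℝ (Fin n) := VectorField.mpullbackWithin 𝓘(ℝ, EuclideanSpace ℝ (Fin n)) (𝓡 n)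
          φ.symm V (Set.range (𝓡 n))
  have : IsManifold (𝓡 n) 2 M := IsManifold.of_le (n := ∞) ENat.LEInfty.out
  have huniv : φ.symm ⁻¹' Set.univ ∩ Set.range (𝓡 n) = Set.univ := by simp
  have hpull : ∀ V : Π p : M, TangentSpace (𝓡 n) p, IsSmoothField V →
      DifferentiableAt ℝ (pull V) (φ p) := by
    intro V hV
    have h := MDifferentiableWithinAt.differentiableWithinAt_mpullbackWithin_vectorField
      (((hV p).mdifferentiableAt (by simp)).mdifferentiableWithinAt (s := Set.univ))
    rw [huniv] at h
    exact differentiableWithinAt_univ.1 h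
  have hsecond : ∀ V W : Π p : M, TangentSpace (𝓡 n) p, IsSmoothField V → IsSmoothField W →
      dirDeriv V (dirDeriv W c) p
        = fderiv ℝ (fun x => fderiv ℝ c' x (pull W x)) (φ p) (pull V (φ p)) := by
    intro V W hV hW
    have h1 : dirDeriv W c =ᶠ[nhds p] fun q => (fun x => fderiv ℝ c' x (pull W x)) (φ q) := by
      filter_upwards [hchart, mvfderiv_extChartAt_apply_field W p] with q h2 h3
      exact (h2 (W q)).trans (congrArg _ h3)
    have h2 : DifferentiableAt ℝ (fun x => fderiv ℝ c' x (pull W x)) (φ p) :=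
      ((hcd.fderiv_right (m := 1)
      (by rw [one_add_one_eq_two]; exact ENat.LEInfty.out)).differentiableAt (by simp)).clm_apply (hpull W hW)
    refine (mvfderiv_congr h1 (V p)).trans ?_
    refine (mvfderiv_comp_of_hasFDerivAt hφ h2.hasFDerivAt (V p)).trans ?_
    exact congrArg _ (mvfderiv_extChartAt_apply_field V p).self_of_nhds
  rw [hsecond X Y hX hY, hsecond Y X hY hX, ← VectorField.fderiv_apply_lieBracket
    (n := ∞) hcd
    (by rw [minSmoothness_of_isRCLikeNormedField]; exact ENat.LEInfty.out) (hpull Y hY) (hpull X hX)]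
  refine (hchart.self_of_nhds _).trans (congrArg _ ?_)
  have h := (isInvertible_mfderiv_extChartAt (I := 𝓡 n)
    (mem_extChartAt_source (I := 𝓡 n) p)).self_apply_inverse
    (show EuclideanSpace ℝ (Fin n) from VectorField.lieBracketWithin ℝ (pull X) (pull Y)
      (φ.symm ⁻¹' Set.univ ∩ Set.range (𝓡 n)) (φ p))
  refine Eq.trans h ?_
  rw [huniv, VectorField.lieBracketWithin_univ]

end Calculus

/-! ### Immersions into an inner product space and the Levi-Civita connection. -/

section Immersion

variable {n : ℕ} {M : Type*} [TopologicalSpace M] [ChartedSpace (EuclideanSpace ℝ (Fin n)) M]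
  {V : Type*} [NormedAddCommGroup V] [InnerProductSpace ℝ V] {f : M → V}

/-- `f` is a smooth immersion into an inner product space. -/
structure IsSmoothImmersion (f : M → V) : Prop where
  smooth : SmoothMap (n := n) f
  injective : ∀ p, Function.Injective (mvfderiv (𝓡 n) f p)

/-- The vector `v ∈ T_pM` represents the tangential part of `c ∈ V`. -/
def IsTangentialPart (f : M → V) (p : M) (c : V) (v : TangentSpace (𝓡 n) p) : Prop :=
  ∀ z : TangentSpace (𝓡 n) p,
    inner ℝ (mvfderiv (𝓡 n) f p v) (mvfderiv (𝓡 n) f p z) = inner ℝ c (mvfderiv (𝓡 n) f p z)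

theorem exists_isTangentialPart (f : M → V) (p : M) (c : V) :
    ∃ v : TangentSpace (𝓡 n) p, IsTangentialPart f p c v := by
  let D : EuclideanSpace ℝ (Fin n) →ₗ[ℝ] V := (mvfderiv (𝓡 n) f p).toLinearMap
  obtain ⟨v, hv⟩ : (LinearMap.range D).starProjection c ∈ LinearMap.range D :=
    Submodule.starProjection_apply_mem _ _
  refine ⟨v, fun z => ?_⟩
  have h : inner ℝ (c - (LinearMap.range D).starProjection c) (D z) = 0 :=
    Submodule.starProjection_inner_eq_zero c (D z) ⟨z, rfl⟩
  rw [← hv, inner_sub_left, sub_eq_zero] at h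
  exact h.symm

theorem IsSmoothImmersion.eq_of_inner_eq (hf : IsSmoothImmersion (n := n) f) {p : M}
    {u v : TangentSpace (𝓡 n) p}
    (h : ∀ z, inner ℝ (mvfderiv (𝓡 n) f p u) (mvfderiv (𝓡 n) f p z)
      = inner ℝ (mvfderiv (𝓡 n) f p v) (mvfderiv (𝓡 n) f p z)) : u = v := by
  apply hf.injective p
  have h' := h (u - v)
  rwa [← sub_eq_zero, ← inner_sub_left, ← map_sub, inner_self_eq_zero, map_sub, sub_eq_zero] at h'

variable [IsManifold (𝓡 n) ∞ M]

/-- In a local trivialization with differential `L`, the field solves the normal equation `Lᵀ L X =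
Lᵀ c`. Injectivity makes `Lᵀ L` invertible, and inversion of operators is smooth. -/
theorem IsSmoothImmersion.isSmoothField (hf : IsSmoothImmersion (n := n) f) {c : M → V}
    (hc : SmoothMap (n := n) c) {X : Π p : M, TangentSpace (𝓡 n) p}
    (hX : ∀ p, IsTangentialPart f p (c p) (X p)) : IsSmoothField X := by
  intro p₀
  rw [Bundle.contMDiffAt_section]
  let T := EuclideanSpace ℝ (Fin n)
  let e := trivializationAt T (TangentSpace (𝓡 n) : M → Type _) p₀
  -- the differential of `f` in the trivialization
  let L : M → (T →L[ℝ] V) := fun q => (mvfderiv (𝓡 n) f q).comp (e.symmL ℝ q)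
  have hL : ContMDiffAt (𝓡 n) 𝓘(ℝ, T →L[ℝ] V) ∞ L p₀ := by
    have h := (hf.smooth p₀).mfderiv_const (m := ∞) (by simp)
    -- The target is a vector space, so only the source coordinates contribute a change of
    -- trivialization.
    have h' : inTangentCoordinates (𝓡 n) 𝓘(ℝ, V) id f (mfderiv (𝓡 n) 𝓘(ℝ, V) f) p₀ = L := by
      funext q
      unfold inTangentCoordinates ContinuousLinearMap.inCoordinates
      rw [TangentBundle.continuousLinearMapAt_model_space]
      rfl
    exact h' ▸ h
  -- `A l v = ⟨v, l ·⟩` is the transpose of `l` with values in the dual; `(A l).comp l` is the Gram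
  -- form of `l`.
  let A : (T →L[ℝ] V) → (V →L[ℝ] (T →L[ℝ] ℝ)) := fun l =>
    ((ContinuousLinearMap.compL ℝ T V ℝ).flip l).comp (innerSL ℝ)
  have hA : ContDiff ℝ ∞ A := by fun_prop
  have hsymm : ∀ q ∈ e.baseSet, L q (e ⟨q, X q⟩).2 = mvfderiv (𝓡 n) f q (X q) := by
    intro q hq
    have h : e.symmL ℝ q (e.continuousLinearMapAt ℝ q (X q)) = X q :=
      e.symmL_continuousLinearMapAt hq (X q)
    rw [e.continuousLinearMapAt_apply (R := ℝ), e.linearMapAt_apply (R := ℝ), if_pos hq] at h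
    exact congrArg (mvfderiv (𝓡 n) f q) h
  have hLinj : ∀ q ∈ e.baseSet, Function.Injective (L q) := fun q hq u v huv => by
    have h := hf.injective q huv
    have h2 := congrArg (e.continuousLinearMapAt ℝ q) h
    exact (e.continuousLinearMapAt_symmL hq u).symm.trans
      (h2.trans (e.continuousLinearMapAt_symmL hq v))
  have hfr : Module.finrank ℝ T = Module.finrank ℝ (T →L[ℝ] ℝ) := by
    rw [← (LinearMap.toContinuousLinearMap (𝕜 := ℝ) (E := T) (F' := ℝ)).finrank_eq]
    exact Subspace.dual_finrank_eq.symm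
  have hinv : ∀ q ∈ e.baseSet, ((A (L q)).comp (L q)).IsInvertible := by
    intro q hq
    have hi : Function.Injective ((A (L q)).comp (L q)).toLinearMap := by
      rw [← LinearMap.ker_eq_bot, LinearMap.ker_eq_bot']
      intro u hu
      have h : inner ℝ (L q u) (L q u) = 0 := congrArg (fun l : T →L[ℝ] ℝ => l u) hu
      rw [inner_self_eq_zero] at h
      exact hLinj q hq (h.trans (map_zero _).symm)
    refine ⟨(LinearEquiv.ofInjectiveOfFinrankEq _ hi hfr).toContinuousLinearEquiv, ?_⟩
    ext u v
    rfl
  have heq : ∀ q ∈ e.baseSet, (e ⟨q, X q⟩).2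
      = ((A (L q)).comp (L q)).inverse (A (L q) (c q)) := by
    intro q hq
    rw [← (hinv q hq).inverse_apply_self (e ⟨q, X q⟩).2]
    congr 1
    ext u
    change inner ℝ (L q (e ⟨q, X q⟩).2) (L q u) = inner ℝ (c q) (L q u)
    rw [hsymm q hq]
    exact hX q _
  have hmem : e.baseSet ∈ nhds p₀ :=
    e.open_baseSet.mem_nhds (FiberBundle.mem_baseSet_trivializationAt' p₀)
  have hAL : ContMDiffAt (𝓡 n) 𝓘(ℝ, V →L[ℝ] (T →L[ℝ] ℝ)) ∞ (fun q => A (L q)) p₀ :=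
    hA.contMDiff.contMDiffAt.comp p₀ hL
  have hG : ContMDiffAt (𝓡 n) 𝓘(ℝ, T →L[ℝ] (T →L[ℝ] ℝ)) ∞ (fun q => (A (L q)).comp (L q)) p₀ :=
    hAL.clm_comp hL
  have hGi : ContMDiffAt (𝓡 n) 𝓘(ℝ, (T →L[ℝ] ℝ) →L[ℝ] T) ∞
      (fun q => ((A (L q)).comp (L q)).inverse) p₀ :=
    (ContinuousLinearMap.IsInvertible.contDiffAt_map_inverse
      (hinv p₀ (mem_of_mem_nhds hmem))).contMDiffAt.comp p₀ hG
  exact (hGi.clm_apply (hAL.clm_apply (hc p₀))).congr_of_eventuallyEq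
    (Filter.eventually_of_mem hmem heq)

/-- The extension is the tangential projection of the constant ambient vector `df u`, so no bump
functions are needed. -/
theorem IsSmoothImmersion.exists_field (hf : IsSmoothImmersion (n := n) f) (p : M)
    (u : TangentSpace (𝓡 n) p) :
    ∃ U : Π q : M, TangentSpace (𝓡 n) q, IsSmoothField U ∧ U p = u := by
  choose U hU using fun q : M => exists_isTangentialPart (n := n) f q (mvfderiv (𝓡 n) f p u)
  exact ⟨U, hf.isSmoothField (c := fun _ => mvfderiv (𝓡 n) f p u) contMDiff_const hU,
    hf.eq_of_inner_eq (hU p)⟩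

variable {g : Π p : M, LinearMap.BilinForm ℝ (TangentSpace (𝓡 n) p)}

/-- The product rule writes each derivative of the metric in second derivatives of `f`, and each
bracket is a commutator of them; all but one pairing cancel. -/
theorem IsSmoothImmersion.koszul_eq (hf : IsSmoothImmersion (n := n) f)
    (hg : ∀ p u v, g p u v = inner ℝ (mvfderiv (𝓡 n) f p u) (mvfderiv (𝓡 n) f p v))
    {X Y Z : Π p : M, TangentSpace (𝓡 n) p} (hX : IsSmoothField X) (hY : IsSmoothField Y)
    (hZ : IsSmoothField Z) (p : M) :
    koszul g X Y Z p = inner ℝ (dirDeriv X (dirDeriv Y f) p) (mvfderiv (𝓡 n) f p (Z p)) := by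
  have key : ∀ {A B C : Π p : M, TangentSpace (𝓡 n) p}, IsSmoothField A → IsSmoothField B →
      IsSmoothField C → fieldDeriv A (fun q => g q (B q) (C q)) p
        = inner ℝ (dirDeriv A (dirDeriv B f) p) (dirDeriv C f p)
          + inner ℝ (dirDeriv A (dirDeriv C f) p) (dirDeriv B f p) := by
    intro A B C hA hB hC
    have h : (fun q => g q (B q) (C q)) = fun q => inner ℝ (dirDeriv B f q) (dirDeriv C f q) :=
      funext fun q => hg q _ _
    rw [h, fieldDeriv, mvfderiv_inner (contMDiff_dirDeriv hB hf.smooth)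
      (contMDiff_dirDeriv hC hf.smooth), real_inner_comm (dirDeriv B f p)]
    rfl
  have br : ∀ {A B C : Π p : M, TangentSpace (𝓡 n) p}, IsSmoothField A → IsSmoothField B →
      g p (VectorField.mlieBracket (𝓡 n) A B p) (C p)
        = inner ℝ (dirDeriv A (dirDeriv B f) p) (dirDeriv C f p)
          - inner ℝ (dirDeriv B (dirDeriv A f) p) (dirDeriv C f p) := by
    intro A B C hA hB
    rw [← inner_sub_left, ← dirDeriv_mlieBracket hA hB hf.smooth, hg]
    rfl
  unfold koszul
  rw [key hX hY hZ, key hY hX hZ, key hZ hX hY, br hX hY, br hX hZ, br hY hZ]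
  unfold dirDeriv
  ring

theorem IsSmoothImmersion.isTangentialPart_leviCivita (hf : IsSmoothImmersion (n := n) f)
    (hg : ∀ p u v, g p u v = inner ℝ (mvfderiv (𝓡 n) f p u) (mvfderiv (𝓡 n) f p v))
    {X Y : Π p : M, TangentSpace (𝓡 n) p} (hX : IsSmoothField X) (hY : IsSmoothField Y) (p : M) :
    IsTangentialPart f p (dirDeriv X (dirDeriv Y f) p) (leviCivita g X Y p) := by
  have h : ∃ v : TangentSpace (𝓡 n) p, ∀ Z : (Π q : M, TangentSpace (𝓡 n) q),
      IsSmoothField Z → g p v (Z p) = koszul g X Y Z p := by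
    obtain ⟨v, hv⟩ := exists_isTangentialPart (n := n) f p (dirDeriv X (dirDeriv Y f) p)
    exact ⟨v, fun Z hZ => by rw [hf.koszul_eq hg hX hY hZ, hg, hv]⟩
  intro z
  -- The Koszul condition tests only against smooth fields, so the vector `z` has to be extended to
  -- one.
  obtain ⟨Z, hZ, rfl⟩ := hf.exists_field p z
  rw [leviCivita, dif_pos h, ← hf.koszul_eq hg hX hY hZ, ← hg]
  exact h.choose_spec Z hZ

theorem IsSmoothImmersion.isSmoothField_leviCivita (hf : IsSmoothImmersion (n := n) f)
    (hg : ∀ p u v, g p u v = inner ℝ (mvfderiv (𝓡 n) f p u) (mvfderiv (𝓡 n) f p v))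
    {X Y : Π p : M, TangentSpace (𝓡 n) p} (hX : IsSmoothField X) (hY : IsSmoothField Y) :
    IsSmoothField (leviCivita g X Y) :=
  hf.isSmoothField (contMDiff_dirDeriv hX (contMDiff_dirDeriv hY hf.smooth))
    (hf.isTangentialPart_leviCivita hg hX hY)

end Immersion

/-! ### The curvature of an induced metric. -/

section Gauss

variable {n : ℕ} {M : Type*} [TopologicalSpace M] [ChartedSpace (EuclideanSpace ℝ (Fin n)) M]
  [IsManifold (𝓡 n) ∞ M]
  {V : Type*} [NormedAddCommGroup V] [InnerProductSpace ℝ V] {f : M → V}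

theorem IsSmoothImmersion.isSmoothField_mlieBracket (hf : IsSmoothImmersion (n := n) f)
    {X Y : Π p : M, TangentSpace (𝓡 n) p} (hX : IsSmoothField X) (hY : IsSmoothField Y) :
    IsSmoothField (VectorField.mlieBracket (𝓡 n) X Y) := by
  -- The bracket is trivially the tangential part of its own image under `df`, and that image is a
  -- smooth commutator.
  refine hf.isSmoothField (c := dirDeriv (VectorField.mlieBracket (𝓡 n) X Y) f) ?_
    fun p z => rfl
  rw [funext (dirDeriv_mlieBracket hX hY hf.smooth)]
  exact ContMDiff.sub (contMDiff_dirDeriv hX (contMDiff_dirDeriv hY hf.smooth))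
    (contMDiff_dirDeriv hY (contMDiff_dirDeriv hX hf.smooth))

variable {g : Π p : M, LinearMap.BilinForm ℝ (TangentSpace (𝓡 n) p)}

/-- Obtained by differentiating `⟨df(∇_Y Z), df W⟩ = ⟨D_Y D_Z f, df W⟩` along `X`, which avoids
differentiating a projection. -/
theorem IsSmoothImmersion.metric_leviCivita_leviCivita (hf : IsSmoothImmersion (n := n) f)
    (hg : ∀ p u v, g p u v = inner ℝ (mvfderiv (𝓡 n) f p u) (mvfderiv (𝓡 n) f p v))
    {X Y Z W : Π p : M, TangentSpace (𝓡 n) p} (hX : IsSmoothField X) (hY : IsSmoothField Y)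
    (hZ : IsSmoothField Z) (hW : IsSmoothField W) (p : M) :
    g p (leviCivita g X (leviCivita g Y Z) p) (W p)
      = inner ℝ (dirDeriv X (dirDeriv Y (dirDeriv Z f)) p) (dirDeriv W f p)
        + inner ℝ (dirDeriv Y (dirDeriv Z f) p) (dirDeriv X (dirDeriv W f) p)
        - g p (leviCivita g Y Z p) (leviCivita g X W p) := by
  have hV := hf.isSmoothField_leviCivita hg hY hZ
  set V := leviCivita g Y Z
  have sm : ∀ {A : Π p : M, TangentSpace (𝓡 n) p}, IsSmoothField A →
      SmoothMap (n := n) (dirDeriv A f) := fun hA => contMDiff_dirDeriv hA hf.smooth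
  have h1 : (fun q => inner ℝ (dirDeriv V f q) (dirDeriv W f q))
      = fun q => inner ℝ (dirDeriv Y (dirDeriv Z f) q) (dirDeriv W f q) :=
    funext fun q => hf.isTangentialPart_leviCivita hg hY hZ q (W q)
  have h2 := congrArg (fun h => mvfderiv (𝓡 n) h p (X p)) h1
  simp only [mvfderiv_inner (sm hV) (sm hW),
    mvfderiv_inner (contMDiff_dirDeriv hY (sm hZ)) (sm hW)] at h2
  have h3 := hf.isTangentialPart_leviCivita hg hX hW p (V p)
  rw [real_inner_comm, real_inner_comm (mvfderiv (𝓡 n) f p (V p))] at h3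
  rw [hg, hf.isTangentialPart_leviCivita hg hX hV, hg, h3]
  unfold dirDeriv at h2 ⊢
  linarith

/-- The third derivatives cancel against the bracket term. What remains is `⟨II(Y,Z), II(X,W)⟩ -
⟨II(X,Z), II(Y,W)⟩`, each pairing written as the full product minus its tangential part. -/
theorem IsSmoothImmersion.riemann_eq (hf : IsSmoothImmersion (n := n) f)
    (hg : ∀ p u v, g p u v = inner ℝ (mvfderiv (𝓡 n) f p u) (mvfderiv (𝓡 n) f p v))
    {X Y Z W : Π p : M, TangentSpace (𝓡 n) p} (hX : IsSmoothField X) (hY : IsSmoothField Y)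
    (hZ : IsSmoothField Z) (hW : IsSmoothField W) (p : M) :
    riemann g X Y Z W p
      = inner ℝ (dirDeriv Y (dirDeriv Z f) p) (dirDeriv X (dirDeriv W f) p)
        - g p (leviCivita g Y Z p) (leviCivita g X W p)
        - (inner ℝ (dirDeriv X (dirDeriv Z f) p) (dirDeriv Y (dirDeriv W f) p)
          - g p (leviCivita g X Z p) (leviCivita g Y W p)) := by
  have hb : g p (leviCivita g (VectorField.mlieBracket (𝓡 n) X Y) Z p) (W p)
      = inner ℝ (dirDeriv X (dirDeriv Y (dirDeriv Z f)) p) (dirDeriv W f p)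
        - inner ℝ (dirDeriv Y (dirDeriv X (dirDeriv Z f)) p) (dirDeriv W f p) := by
    rw [hg, hf.isTangentialPart_leviCivita hg (hf.isSmoothField_mlieBracket hX hY) hZ,
      dirDeriv_mlieBracket hX hY (contMDiff_dirDeriv hZ hf.smooth), inner_sub_left]
    rfl
  rw [riemann, map_sub, map_sub, LinearMap.sub_apply, LinearMap.sub_apply,
    hf.metric_leviCivita_leviCivita hg hX hY hZ hW, hf.metric_leviCivita_leviCivita hg hY hX hZ hW,
    hb]
  ring

end Gauss

/-! ### Hypersurfaces of the sphere as Legendre pairs. -/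

section Legendre

variable {n : ℕ} {M : Type*} [TopologicalSpace M] [ChartedSpace (EuclideanSpace ℝ (Fin n)) M]
  {V : Type*} [NormedAddCommGroup V] [InnerProductSpace ℝ V] {P N : M → V}

/-- A hypersurface `P` of the unit sphere of `V` with its unit normal field `N`. -/
structure IsLegendrePair (P N : M → V) : Prop extends IsSmoothImmersion (n := n) P where
  smooth_normal : SmoothMap (n := n) N
  inner_self : ∀ p, inner ℝ (P p) (P p) = 1
  inner_normal_self : ∀ p, inner ℝ (N p) (N p) = 1
  inner_normal : ∀ p, inner ℝ (P p) (N p) = 0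
  inner_deriv_normal : ∀ p (u : TangentSpace (𝓡 n) p), inner ℝ (mvfderiv (𝓡 n) P p u) (N p) = 0

namespace IsLegendrePair

theorem inner_deriv_self (h : IsLegendrePair (n := n) P N) (p : M) (u : TangentSpace (𝓡 n) p) :
    inner ℝ (mvfderiv (𝓡 n) P p u) (P p) = 0 := by
  have h1 := mvfderiv_inner h.smooth h.smooth p u
  rw [funext h.inner_self, mvfderiv_const, real_inner_comm] at h1
  simp only [zero_apply] at h1
  linarith [real_inner_comm (P p) (mvfderiv (𝓡 n) P p u)]

theorem inner_normalDeriv_normal (h : IsLegendrePair (n := n) P N) (p : M) (u : TangentSpace (𝓡 n) p) :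
    inner ℝ (mvfderiv (𝓡 n) N p u) (N p) = 0 := by
  have h1 := mvfderiv_inner h.smooth_normal h.smooth_normal p u
  rw [funext h.inner_normal_self, mvfderiv_const, real_inner_comm] at h1
  simp only [zero_apply] at h1
  linarith [real_inner_comm (N p) (mvfderiv (𝓡 n) N p u)]

theorem inner_normalDeriv_self (h : IsLegendrePair (n := n) P N) (p : M) (u : TangentSpace (𝓡 n) p) :
    inner ℝ (mvfderiv (𝓡 n) N p u) (P p) = 0 := by
  have h1 := mvfderiv_inner h.smooth h.smooth_normal p u
  rw [funext h.inner_normal, mvfderiv_const, h.inner_deriv_normal, real_inner_comm] at h1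
  simpa using h1.symm

variable [IsManifold (𝓡 n) ∞ M]

/-- Differentiating an orthogonality relation `⟨dQ, R⟩ = 0` once more. -/
theorem inner_dirDeriv_dirDeriv {Q R : M → V} (hQ : SmoothMap (n := n) Q)
    (hR : SmoothMap (n := n) R)
    (hQR : ∀ p (u : TangentSpace (𝓡 n) p), inner ℝ (mvfderiv (𝓡 n) Q p u) (R p) = 0)
    {X Y : Π p : M, TangentSpace (𝓡 n) p} (hY : IsSmoothField Y) (p : M) :
    inner ℝ (dirDeriv X (dirDeriv Y Q) p) (R p)
      = -inner ℝ (mvfderiv (𝓡 n) Q p (Y p)) (mvfderiv (𝓡 n) R p (X p)) := by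
  have h1 := mvfderiv_inner (contMDiff_dirDeriv hY hQ) hR p (X p)
  have h2 : (fun q => inner ℝ (dirDeriv Y Q q) (R q)) = fun _ => 0 := funext fun q => hQR q (Y q)
  rw [h2, mvfderiv_const] at h1
  unfold dirDeriv at h1 ⊢
  simp only [zero_apply] at h1
  linarith

/-- Symmetry of the second fundamental form: `[X,Y]` is tangent, so `D_X D_Y P - D_Y D_X P` is
orthogonal to `N`. For `(P, N)` this is the Lagrangian condition. -/
theorem inner_deriv_normalDeriv_comm (h : IsLegendrePair (n := n) P N) (p : M)
    (u v : TangentSpace (𝓡 n) p) :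
    inner ℝ (mvfderiv (𝓡 n) P p u) (mvfderiv (𝓡 n) N p v)
      = inner ℝ (mvfderiv (𝓡 n) N p u) (mvfderiv (𝓡 n) P p v) := by
  obtain ⟨X, hX, rfl⟩ := h.toIsSmoothImmersion.exists_field p u
  obtain ⟨Y, hY, rfl⟩ := h.toIsSmoothImmersion.exists_field p v
  have h1 := inner_dirDeriv_dirDeriv h.smooth h.smooth_normal h.inner_deriv_normal (X := Y) hX p
  have h2 := inner_dirDeriv_dirDeriv h.smooth h.smooth_normal h.inner_deriv_normal (X := X) hY p
  have h3 := congrArg (fun w => inner ℝ w (N p)) (dirDeriv_mlieBracket hX hY h.smooth p)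
  simp only [inner_sub_left, h1, h2] at h3
  have h4 := h.inner_deriv_normal p (VectorField.mlieBracket (𝓡 n) X Y p)
  unfold dirDeriv at h3
  rw [h4] at h3
  rw [real_inner_comm _ (mvfderiv (𝓡 n) N p (X p))]
  linarith

end IsLegendrePair

end Legendre

/-! ### The orthonormal frame of the doubled space. -/

section Doubling

variable {V : Type*} [NormedAddCommGroup V] [InnerProductSpace ℝ V]

/-- The map `(x, y) ↦ (x, y) / √2` into the Hilbert sum of two copies of `V`. -/
def doubling : V × V →L[ℝ] WithLp 2 (V × V) :=
  (Real.sqrt 2)⁻¹ • ((WithLp.prodContinuousLinearEquiv 2 ℝ V V).symm : V × V →L[ℝ] WithLp 2 (V × V))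

theorem doubling_apply (x y : V) :
    doubling (x, y) = (Real.sqrt 2)⁻¹ • WithLp.toLp 2 (x, y) := rfl

theorem inner_toLp_prod (x y z w : V) :
    inner ℝ (WithLp.toLp 2 (x, y)) (WithLp.toLp 2 (z, w)) = inner ℝ x z + inner ℝ y w :=
  WithLp.prod_inner_apply _ _

theorem inner_doubling_toLp (x y z w : V) :
    inner ℝ (doubling (x, y)) (WithLp.toLp 2 (z, w))
      = (Real.sqrt 2)⁻¹ * (inner ℝ x z + inner ℝ y w) := by
  rw [doubling_apply, real_inner_smul_left, inner_toLp_prod]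

theorem inner_doubling (x y z w : V) :
    inner ℝ (doubling (x, y)) (doubling (z, w)) = 1 / 2 * (inner ℝ x z + inner ℝ y w) := by
  have h2 : (Real.sqrt 2)⁻¹ * (Real.sqrt 2)⁻¹ = 1 / 2 := by
    rw [← mul_inv, Real.mul_self_sqrt (by norm_num)]; norm_num
  rw [doubling_apply z w, real_inner_smul_right, inner_doubling_toLp, ← mul_assoc, h2]

/-- Parseval's identity for the basis made of `(a, b)/√2`, `(b, -a)/√2` and the four vectors built
from `P` and `N`. `hlag` makes the first two families orthogonal; the scaling by `1/√2` produces the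
factors `1/2`. -/
theorem sum_inner_lagrangian_frame [FiniteDimensional ℝ V] {n : ℕ}
    (hV : Module.finrank ℝ V = n + 2) {a b : Fin n → V} {P N : V}
    (hab : ∀ i j, inner ℝ (a i) (a j) + inner ℝ (b i) (b j) = if i = j then 2 else 0)
    (hlag : ∀ i j, inner ℝ (a i) (b j) = inner ℝ (b i) (a j))
    (haP : ∀ i, inner ℝ (a i) P = 0) (haN : ∀ i, inner ℝ (a i) N = 0)
    (hbP : ∀ i, inner ℝ (b i) P = 0) (hbN : ∀ i, inner ℝ (b i) N = 0)
    (hP : inner ℝ P P = 1) (hN : inner ℝ N N = 1) (hPN : inner ℝ P N = 0) (x y z w : V) :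
    inner ℝ x z + inner ℝ y w
      = 1 / 2 * ∑ i, (inner ℝ x (a i) + inner ℝ y (b i)) * (inner ℝ z (a i) + inner ℝ w (b i))
        + 1 / 2 * ∑ i, (inner ℝ x (b i) - inner ℝ y (a i)) * (inner ℝ z (b i) - inner ℝ w (a i))
        + (inner ℝ x P * inner ℝ z P + inner ℝ x N * inner ℝ z N
          + inner ℝ y P * inner ℝ w P + inner ℝ y N * inner ℝ w N) := by
  let c : Fin 4 → V × V := ![(P, 0), (N, 0), (0, P), (0, N)]
  let v : Fin n ⊕ Fin n ⊕ Fin 4 → WithLp 2 (V × V) :=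
    Sum.elim (fun i => doubling (a i, b i))
      (Sum.elim (fun i => doubling (b i, -a i)) (fun k => WithLp.toLp 2 (c k)))
  have hNP : inner ℝ N P = 0 := by rw [real_inner_comm, hPN]
  have hperp : ∀ i k, inner ℝ (doubling (a i, b i)) (WithLp.toLp 2 (c k)) = 0 ∧
      inner ℝ (doubling (b i, -a i)) (WithLp.toLp 2 (c k)) = 0 := by
    intro i k
    fin_cases k <;> simp [c, -WithLp.prod_inner_apply, inner_doubling_toLp, haP, haN, hbP, hbN]
  have hc : ∀ k l, inner ℝ (WithLp.toLp 2 (c k)) (WithLp.toLp 2 (c l))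
      = if k = l then (1 : ℝ) else 0 := by
    intro k l
    fin_cases k <;> fin_cases l <;> simp [c, inner_toLp_prod, -WithLp.prod_inner_apply, -inner_self_eq_norm_sq_to_K,
      hP, hN, hPN, hNP]
  have hon : Orthonormal ℝ v := by
    rw [orthonormal_iff_ite]
    rintro (i | i | k) (j | j | l)
    · simp only [v, Sum.elim_inl, inner_doubling, hab, Sum.inl.injEq]
      split_ifs <;> norm_num
    · simp [v, inner_doubling, -WithLp.prod_inner_apply, hlag]
    · simpa [v] using (hperp i l).1
    · simp [v, inner_doubling, -WithLp.prod_inner_apply, hlag]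
    · simp only [v, Sum.elim_inl, Sum.elim_inr, inner_doubling, inner_neg_neg, Sum.inr.injEq,
        Sum.inl.injEq]
      rw [add_comm, hab]
      split_ifs <;> norm_num
    · simpa [v] using (hperp i l).2
    · rw [real_inner_comm]; simpa [v] using (hperp j k).1
    · rw [real_inner_comm]; simpa [v] using (hperp j k).2
    · simpa only [v, Sum.elim_inr, Sum.inr.injEq] using hc k l
  -- The count `n + n + 4 = 2(n + 2)` turns the orthonormal family into a basis.
  have hcard : Fintype.card (Fin n ⊕ Fin n ⊕ Fin 4) = Module.finrank ℝ (WithLp 2 (V × V)) := by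
    rw [(WithLp.linearEquiv 2 ℝ (V × V)).finrank_eq, Module.finrank_prod, hV]
    simp only [Fintype.card_sum, Fintype.card_fin]
    ring
  have hspan : ⊤ ≤ Submodule.span ℝ (Set.range v) :=
    (hon.linearIndependent.span_eq_top_of_card_eq_finrank' hcard).ge
  have key := (OrthonormalBasis.mk hon hspan).sum_inner_mul_inner
    (WithLp.toLp 2 (x, y)) (WithLp.toLp 2 (z, w))
  have h2 : (Real.sqrt 2)⁻¹ * (Real.sqrt 2)⁻¹ = 1 / 2 := by
    rw [← mul_inv, Real.mul_self_sqrt (by norm_num)]; norm_num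
  rw [inner_toLp_prod] at key
  rw [← key]
  simp only [OrthonormalBasis.coe_mk, Fintype.sum_sum_type, v, Sum.elim_inl, Sum.elim_inr,
    Fin.sum_univ_four, inner_doubling_toLp, real_inner_comm _ (WithLp.toLp 2 (x, y)), c]
  rw [Finset.mul_sum, Finset.mul_sum, ← add_assoc]
  congr 1
  · congr 1
    · refine Finset.sum_congr rfl fun i _ => ?_
      rw [← h2, real_inner_comm (a i) x, real_inner_comm (b i) y, real_inner_comm (a i) z,
        real_inner_comm (b i) w]
      ring
    · refine Finset.sum_congr rfl fun i _ => ?_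
      rw [← h2, inner_neg_left, inner_neg_left, real_inner_comm (a i) y, real_inner_comm (b i) x,
        real_inner_comm (a i) w, real_inner_comm (b i) z]
      ring
  · simp [inner_toLp_prod, -WithLp.prod_inner_apply, real_inner_comm]

end Doubling

/-! ### Gauss and Codazzi equations in terms of the cubic form. -/

section LagrangianEquations

variable {n : ℕ} {M : Type*} [TopologicalSpace M] [ChartedSpace (EuclideanSpace ℝ (Fin n)) M]
  {V : Type*} [NormedAddCommGroup V] [InnerProductSpace ℝ V] {P N : M → V}

/-- The cubic form `Ω(D_X D_Y (P,N), d(P,N) z)` of a Legendre pair, with `Ω` the symplectic form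
of `V × V`. -/
def cubicForm (P N : M → V) (X Y : Π p : M, TangentSpace (𝓡 n) p) (p : M)
    (z : TangentSpace (𝓡 n) p) : ℝ :=
  inner ℝ (dirDeriv X (dirDeriv Y P) p) (mvfderiv (𝓡 n) N p z)
    - inner ℝ (dirDeriv X (dirDeriv Y N) p) (mvfderiv (𝓡 n) P p z)

/-- The metric `½ (⟨dP, dP⟩ + ⟨dN, dN⟩)` of the map `(P, N) / √2`. -/
def IsPairMetric (P N : M → V) (g : Π p : M, LinearMap.BilinForm ℝ (TangentSpace (𝓡 n) p)) :
    Prop :=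
  ∀ p u v, g p u v = 1 / 2 * (inner ℝ (mvfderiv (𝓡 n) P p u) (mvfderiv (𝓡 n) P p v)
    + inner ℝ (mvfderiv (𝓡 n) N p u) (mvfderiv (𝓡 n) N p v))

theorem mvfderiv_doubling {c d : M → V} (hc : SmoothMap (n := n) c) (hd : SmoothMap (n := n) d)
    (p : M) (u : TangentSpace (𝓡 n) p) :
    mvfderiv (𝓡 n) (fun q => doubling (c q, d q)) p u
      = doubling (mvfderiv (𝓡 n) c p u, mvfderiv (𝓡 n) d p u) := by
  rw [mvfderiv_clm_comp (hc.prodMk_space hd), mvfderiv_prodMk hc hd]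

theorem dirDeriv_doubling {c d : M → V} (hc : SmoothMap (n := n) c) (hd : SmoothMap (n := n) d)
    (X : Π p : M, TangentSpace (𝓡 n) p) :
    dirDeriv X (fun q => doubling (c q, d q))
      = fun q => doubling (dirDeriv X c q, dirDeriv X d q) :=
  funext fun q => mvfderiv_doubling hc hd q (X q)

namespace IsLegendrePair

theorem isSmoothImmersion_doubling (h : IsLegendrePair (n := n) P N) :
    IsSmoothImmersion (n := n) (fun q => doubling (P q, N q)) where
  smooth := doubling.contDiff.contMDiff.comp (h.smooth.prodMk_space h.smooth_normal)
  injective p u v huv := by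
    rw [mvfderiv_doubling h.smooth h.smooth_normal, mvfderiv_doubling h.smooth h.smooth_normal,
      ← sub_eq_zero, ← map_sub, Prod.mk_sub_mk, ← map_sub, ← map_sub] at huv
    have h1 := congrArg (fun w => inner ℝ w w) huv
    simp only [inner_doubling, inner_zero_left] at h1
    have h2 : inner ℝ (mvfderiv (𝓡 n) P p (u - v)) (mvfderiv (𝓡 n) P p (u - v)) = 0 := by
      linarith [real_inner_self_nonneg (x := mvfderiv (𝓡 n) P p (u - v)),
        real_inner_self_nonneg (x := mvfderiv (𝓡 n) N p (u - v))]
    rw [inner_self_eq_zero, map_sub, sub_eq_zero] at h2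
    exact h.injective p h2

variable {g : Π p : M, LinearMap.BilinForm ℝ (TangentSpace (𝓡 n) p)}

theorem metric_eq_inner_doubling (h : IsLegendrePair (n := n) P N) (hg : IsPairMetric P N g)
    (p : M) (u v : TangentSpace (𝓡 n) p) :
    g p u v = inner ℝ (mvfderiv (𝓡 n) (fun q => doubling (P q, N q)) p u)
      (mvfderiv (𝓡 n) (fun q => doubling (P q, N q)) p v) := by
  rw [mvfderiv_doubling h.smooth h.smooth_normal, mvfderiv_doubling h.smooth h.smooth_normal,
    inner_doubling, hg]

variable [IsManifold (𝓡 n) ∞ M] {X Y Z W : Π p : M, TangentSpace (𝓡 n) p}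

theorem dirDeriv_dirDeriv_doubling (h : IsLegendrePair (n := n) P N)
    (hY : IsSmoothField Y) (X : Π p : M, TangentSpace (𝓡 n) p) (p : M) :
    dirDeriv X (dirDeriv Y (fun q => doubling (P q, N q))) p
      = doubling (dirDeriv X (dirDeriv Y P) p, dirDeriv X (dirDeriv Y N) p) := by
  rw [dirDeriv_doubling h.smooth h.smooth_normal, dirDeriv_doubling
    (contMDiff_dirDeriv hY h.smooth) (contMDiff_dirDeriv hY h.smooth_normal)]

theorem isSmoothField_leviCivita (h : IsLegendrePair (n := n) P N) (hg : IsPairMetric P N g)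
    (hX : IsSmoothField X) (hY : IsSmoothField Y) : IsSmoothField (leviCivita g X Y) :=
  h.isSmoothImmersion_doubling.isSmoothField_leviCivita (h.metric_eq_inner_doubling hg) hX hY

theorem metric_leviCivita (h : IsLegendrePair (n := n) P N) (hg : IsPairMetric P N g)
    (hX : IsSmoothField X) (hY : IsSmoothField Y) (p : M) (z : TangentSpace (𝓡 n) p) :
    g p (leviCivita g X Y p) z
      = 1 / 2 * (inner ℝ (dirDeriv X (dirDeriv Y P) p) (mvfderiv (𝓡 n) P p z)
        + inner ℝ (dirDeriv X (dirDeriv Y N) p) (mvfderiv (𝓡 n) N p z)) := by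
  rw [h.metric_eq_inner_doubling hg, h.isSmoothImmersion_doubling.isTangentialPart_leviCivita
    (h.metric_eq_inner_doubling hg) hX hY, h.dirDeriv_dirDeriv_doubling hY,
    mvfderiv_doubling h.smooth h.smooth_normal, inner_doubling]

theorem leviCivita_sub_leviCivita (h : IsLegendrePair (n := n) P N) (hg : IsPairMetric P N g)
    (hX : IsSmoothField X) (hY : IsSmoothField Y) (p : M) :
    leviCivita g X Y p - leviCivita g Y X p = VectorField.mlieBracket (𝓡 n) X Y p := by
  have hf := h.isSmoothImmersion_doubling
  have hg' := h.metric_eq_inner_doubling hg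
  refine hf.eq_of_inner_eq fun z => ?_
  rw [map_sub, inner_sub_left, hf.isTangentialPart_leviCivita hg' hX hY,
    hf.isTangentialPart_leviCivita hg' hY hX, ← inner_sub_left,
    ← dirDeriv_mlieBracket hX hY hf.smooth]
  rfl

/-- The derivative along `X` of the Lagrangian relation `⟨dP Y, dN Z⟩ = ⟨dN Y, dP Z⟩`. -/
theorem cubicForm_comm (h : IsLegendrePair (n := n) P N) (hY : IsSmoothField Y)
    (hZ : IsSmoothField Z) (X : Π p : M, TangentSpace (𝓡 n) p) (p : M) :
    cubicForm P N X Y p (Z p) = cubicForm P N X Z p (Y p) := by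
  have h1 : (fun q => inner ℝ (dirDeriv Y P q) (dirDeriv Z N q))
      = fun q => inner ℝ (dirDeriv Y N q) (dirDeriv Z P q) :=
    funext fun q => h.inner_deriv_normalDeriv_comm q _ _
  have h2 := congrArg (fun c => mvfderiv (𝓡 n) c p (X p)) h1
  simp only [mvfderiv_inner (contMDiff_dirDeriv hY h.smooth) (contMDiff_dirDeriv hZ h.smooth_normal),
    mvfderiv_inner (contMDiff_dirDeriv hY h.smooth_normal) (contMDiff_dirDeriv hZ h.smooth)] at h2
  unfold cubicForm
  rw [real_inner_comm (mvfderiv (𝓡 n) N p (Y p)), real_inner_comm (mvfderiv (𝓡 n) P p (Y p))]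
  unfold dirDeriv at h2 ⊢
  linarith

/-- The expansion of `⟨x,z⟩ + ⟨y,w⟩` in the frame of `V × V` given by an orthonormal frame `e` of
`T_pM`, its rotation by the complex structure, and the four normal directions. -/
theorem inner_add_inner_eq [FiniteDimensional ℝ V] (hV : Module.finrank ℝ V = n + 2)
    (h : IsLegendrePair (n := n) P N) (hg : IsPairMetric P N g) {p : M}
    {e : Fin n → TangentSpace (𝓡 n) p}
    (he : ∀ i j, g p (e i) (e j) = if i = j then 1 else 0) (x y z w : V) :
    inner ℝ x z + inner ℝ y w
      = 1 / 2 * ∑ i, (inner ℝ x (mvfderiv (𝓡 n) P p (e i)) + inner ℝ y (mvfderiv (𝓡 n) N p (e i)))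
          * (inner ℝ z (mvfderiv (𝓡 n) P p (e i)) + inner ℝ w (mvfderiv (𝓡 n) N p (e i)))
        + 1 / 2 * ∑ i, (inner ℝ x (mvfderiv (𝓡 n) N p (e i)) - inner ℝ y (mvfderiv (𝓡 n) P p (e i)))
          * (inner ℝ z (mvfderiv (𝓡 n) N p (e i)) - inner ℝ w (mvfderiv (𝓡 n) P p (e i)))
        + (inner ℝ x (P p) * inner ℝ z (P p) + inner ℝ x (N p) * inner ℝ z (N p)
          + inner ℝ y (P p) * inner ℝ w (P p) + inner ℝ y (N p) * inner ℝ w (N p)) := by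
  refine sum_inner_lagrangian_frame hV (fun i j => ?_)
    (fun i j => h.inner_deriv_normalDeriv_comm p _ _)
    (fun i => h.inner_deriv_self p _) (fun i => h.inner_deriv_normal p _)
    (fun i => h.inner_normalDeriv_self p _) (fun i => h.inner_normalDeriv_normal p _)
    (h.inner_self p) (h.inner_normal_self p) (h.inner_normal p) x y z w
  have h1 := he i j
  rw [hg] at h1
  split_ifs at h1 ⊢ <;> linarith

theorem metric_eq_sum [FiniteDimensional ℝ V] (hV : Module.finrank ℝ V = n + 2)
    (h : IsLegendrePair (n := n) P N) (hg : IsPairMetric P N g) {p : M}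
    {e : Fin n → TangentSpace (𝓡 n) p}
    (he : ∀ i j, g p (e i) (e j) = if i = j then 1 else 0) (u v : TangentSpace (𝓡 n) p) :
    g p u v = ∑ i, g p u (e i) * g p v (e i) := by
  rw [hg, h.inner_add_inner_eq hV hg he]
  simp only [h.inner_deriv_normalDeriv_comm, sub_self, zero_mul, Finset.sum_const_zero,
    h.inner_deriv_self, h.inner_deriv_normal, h.inner_normalDeriv_self, h.inner_normalDeriv_normal]
  rw [Finset.mul_sum]
  simp only [mul_zero, add_zero, Finset.mul_sum, hg p]
  refine Finset.sum_congr rfl fun i _ => by ring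

/-- The cubic form is the pairing with the rotated vector `(dN u, -dP u)`, which has components only
along the rotated frame. -/
theorem cubicForm_eq_sum [FiniteDimensional ℝ V] (hV : Module.finrank ℝ V = n + 2)
    (h : IsLegendrePair (n := n) P N) (hg : IsPairMetric P N g) {p : M}
    {e : Fin n → TangentSpace (𝓡 n) p}
    (he : ∀ i j, g p (e i) (e j) = if i = j then 1 else 0) (u : TangentSpace (𝓡 n) p) :
    cubicForm P N X Y p u = ∑ i, g p u (e i) * cubicForm P N X Y p (e i) := by
  have h1 := h.inner_add_inner_eq hV hg he (dirDeriv X (dirDeriv Y P) p)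
    (dirDeriv X (dirDeriv Y N) p) (mvfderiv (𝓡 n) N p u) (-mvfderiv (𝓡 n) P p u)
  simp only [inner_neg_left, inner_neg_right, h.inner_deriv_normalDeriv_comm, add_neg_cancel,
    mul_zero, Finset.sum_const_zero, h.inner_deriv_self, h.inner_deriv_normal,
    h.inner_normalDeriv_self, h.inner_normalDeriv_normal, neg_zero, add_zero, zero_add,
    sub_neg_eq_add] at h1
  rw [cubicForm, sub_eq_add_neg, h1, Finset.mul_sum]
  refine Finset.sum_congr rfl fun i _ => ?_
  rw [hg, cubicForm]
  ring

theorem inner_dirDeriv_dirDeriv_self (h : IsLegendrePair (n := n) P N)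
    (hY : IsSmoothField Y) (X : Π p : M, TangentSpace (𝓡 n) p) (p : M) :
    inner ℝ (dirDeriv X (dirDeriv Y P) p) (P p) = -inner ℝ (dirDeriv Y P p) (dirDeriv X P p)
    ∧ inner ℝ (dirDeriv X (dirDeriv Y P) p) (N p) = -inner ℝ (dirDeriv Y P p) (dirDeriv X N p)
    ∧ inner ℝ (dirDeriv X (dirDeriv Y N) p) (P p) = -inner ℝ (dirDeriv Y N p) (dirDeriv X P p)
    ∧ inner ℝ (dirDeriv X (dirDeriv Y N) p) (N p) = -inner ℝ (dirDeriv Y N p) (dirDeriv X N p) :=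
  ⟨inner_dirDeriv_dirDeriv h.smooth h.smooth h.inner_deriv_self hY p,
   inner_dirDeriv_dirDeriv h.smooth h.smooth_normal h.inner_deriv_normal hY p,
   inner_dirDeriv_dirDeriv h.smooth_normal h.smooth h.inner_normalDeriv_self hY p,
   inner_dirDeriv_dirDeriv h.smooth_normal h.smooth_normal h.inner_normalDeriv_normal hY p⟩

/-- Frame expansion of two second derivatives: the tangent frame gives the connection, the rotated
frame the cubic form, and the four remaining directions are reduced to first derivatives by
`inner_dirDeriv_dirDeriv_self`. -/
theorem inner_secondDeriv_eq [FiniteDimensional ℝ V] (hV : Module.finrank ℝ V = n + 2)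
    (h : IsLegendrePair (n := n) P N) (hg : IsPairMetric P N g) (hX : IsSmoothField X)
    (hY : IsSmoothField Y) (hZ : IsSmoothField Z) (hW : IsSmoothField W) {p : M}
    {e : Fin n → TangentSpace (𝓡 n) p}
    (he : ∀ i j, g p (e i) (e j) = if i = j then 1 else 0) :
    inner ℝ (dirDeriv X (dirDeriv Y P) p) (dirDeriv Z (dirDeriv W P) p)
        + inner ℝ (dirDeriv X (dirDeriv Y N) p) (dirDeriv Z (dirDeriv W N) p)
      = 2 * g p (leviCivita g X Y p) (leviCivita g Z W p)
        + 1 / 2 * ∑ i, cubicForm P N X Y p (e i) * cubicForm P N Z W p (e i)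
        + (inner ℝ (dirDeriv Y P p) (dirDeriv X P p) * inner ℝ (dirDeriv W P p) (dirDeriv Z P p)
          + inner ℝ (dirDeriv Y P p) (dirDeriv X N p) * inner ℝ (dirDeriv W P p) (dirDeriv Z N p)
          + inner ℝ (dirDeriv Y N p) (dirDeriv X P p) * inner ℝ (dirDeriv W N p) (dirDeriv Z P p)
          + inner ℝ (dirDeriv Y N p) (dirDeriv X N p)
            * inner ℝ (dirDeriv W N p) (dirDeriv Z N p)) := by
  obtain ⟨a1, a2, a3, a4⟩ := h.inner_dirDeriv_dirDeriv_self hY X p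
  obtain ⟨b1, b2, b3, b4⟩ := h.inner_dirDeriv_dirDeriv_self hW Z p
  rw [h.inner_add_inner_eq hV hg he, a1, a2, a3, a4, b1, b2, b3, b4, h.metric_eq_sum hV hg he]
  simp only [h.metric_leviCivita hg hX hY, h.metric_leviCivita hg hZ hW, cubicForm,
    Finset.mul_sum, neg_mul_neg]
  congr 2
  refine Finset.sum_congr rfl fun i _ => by ring

/-- The same expansion with the second vector rotated. Rotation exchanges the tangent and rotated
frames, so connection and cubic form are now paired with each other. -/
theorem symplectic_secondDeriv_eq [FiniteDimensional ℝ V] (hV : Module.finrank ℝ V = n + 2)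
    (h : IsLegendrePair (n := n) P N) (hg : IsPairMetric P N g) (hX : IsSmoothField X)
    (hY : IsSmoothField Y) (hZ : IsSmoothField Z) (hW : IsSmoothField W) {p : M}
    {e : Fin n → TangentSpace (𝓡 n) p}
    (he : ∀ i j, g p (e i) (e j) = if i = j then 1 else 0) :
    inner ℝ (dirDeriv X (dirDeriv Y P) p) (dirDeriv Z (dirDeriv W N) p)
        - inner ℝ (dirDeriv X (dirDeriv Y N) p) (dirDeriv Z (dirDeriv W P) p)
      = cubicForm P N X Y p (leviCivita g Z W p) - cubicForm P N Z W p (leviCivita g X Y p)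
        + (inner ℝ (dirDeriv Y P p) (dirDeriv X P p) * inner ℝ (dirDeriv W N p) (dirDeriv Z P p)
          + inner ℝ (dirDeriv Y P p) (dirDeriv X N p) * inner ℝ (dirDeriv W N p) (dirDeriv Z N p)
          - inner ℝ (dirDeriv Y N p) (dirDeriv X P p) * inner ℝ (dirDeriv W P p) (dirDeriv Z P p)
          - inner ℝ (dirDeriv Y N p) (dirDeriv X N p)
            * inner ℝ (dirDeriv W P p) (dirDeriv Z N p)) := by
  obtain ⟨a1, a2, a3, a4⟩ := h.inner_dirDeriv_dirDeriv_self hY X p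
  obtain ⟨b1, b2, b3, b4⟩ := h.inner_dirDeriv_dirDeriv_self hW Z p
  have h1 := h.inner_add_inner_eq hV hg he (dirDeriv X (dirDeriv Y P) p)
    (dirDeriv X (dirDeriv Y N) p) (dirDeriv Z (dirDeriv W N) p) (-dirDeriv Z (dirDeriv W P) p)
  simp only [inner_neg_left, inner_neg_right, a1, a2, a3, a4, b1, b2, b3, b4] at h1
  rw [sub_eq_add_neg, h1, h.cubicForm_eq_sum hV hg he (leviCivita g Z W p),
    h.cubicForm_eq_sum hV hg he (leviCivita g X Y p), ← Finset.sum_sub_distrib, Finset.mul_sum,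
    Finset.mul_sum, ← Finset.sum_add_distrib]
  simp only [h.metric_leviCivita hg hX hY, h.metric_leviCivita hg hZ hW, cubicForm]
  have h2 : ∀ a b c d : ℝ, a = b → c = d → a + c = b + d := fun a b c d => by rintro rfl rfl; rfl
  refine h2 _ _ _ _ (Finset.sum_congr rfl fun i _ => by ring) (by ring)

theorem riemann_eq [FiniteDimensional ℝ V] (hV : Module.finrank ℝ V = n + 2)
    (h : IsLegendrePair (n := n) P N) (hg : IsPairMetric P N g) (hX : IsSmoothField X)
    (hY : IsSmoothField Y) (hZ : IsSmoothField Z) (hW : IsSmoothField W) {p : M}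
    {e : Fin n → TangentSpace (𝓡 n) p}
    (he : ∀ i j, g p (e i) (e j) = if i = j then 1 else 0) :
    riemann g X Y Z W p
      = 1 / 4 * ∑ i, (cubicForm P N X W p (e i) * cubicForm P N Y Z p (e i)
          - cubicForm P N X Z p (e i) * cubicForm P N Y W p (e i))
        + 1 / 2 * (inner ℝ (dirDeriv Z P p) (dirDeriv Y P p) * inner ℝ (dirDeriv W P p) (dirDeriv X P p)
          + inner ℝ (dirDeriv Z P p) (dirDeriv Y N p) * inner ℝ (dirDeriv W P p) (dirDeriv X N p)
          + inner ℝ (dirDeriv Z N p) (dirDeriv Y P p) * inner ℝ (dirDeriv W N p) (dirDeriv X P p)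
          + inner ℝ (dirDeriv Z N p) (dirDeriv Y N p) * inner ℝ (dirDeriv W N p) (dirDeriv X N p))
        - 1 / 2 * (inner ℝ (dirDeriv Z P p) (dirDeriv X P p) * inner ℝ (dirDeriv W P p) (dirDeriv Y P p)
          + inner ℝ (dirDeriv Z P p) (dirDeriv X N p) * inner ℝ (dirDeriv W P p) (dirDeriv Y N p)
          + inner ℝ (dirDeriv Z N p) (dirDeriv X P p) * inner ℝ (dirDeriv W N p) (dirDeriv Y P p)
          + inner ℝ (dirDeriv Z N p) (dirDeriv X N p)
            * inner ℝ (dirDeriv W N p) (dirDeriv Y N p)) := by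
  rw [h.isSmoothImmersion_doubling.riemann_eq (h.metric_eq_inner_doubling hg) hX hY hZ hW]
  simp only [h.dirDeriv_dirDeriv_doubling, hZ, hW, inner_doubling,
    h.inner_secondDeriv_eq hV hg hY hZ hX hW he, h.inner_secondDeriv_eq hV hg hX hZ hY hW he]
  simp only [Finset.sum_sub_distrib, mul_comm (cubicForm P N X W p _)]
  ring

theorem covDerivTensor_cubicForm_sub [FiniteDimensional ℝ V] (hV : Module.finrank ℝ V = n + 2)
    (h : IsLegendrePair (n := n) P N) (hg : IsPairMetric P N g) (hX : IsSmoothField X)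
    (hY : IsSmoothField Y) (hZ : IsSmoothField Z) (hW : IsSmoothField W) {p : M}
    {e : Fin n → TangentSpace (𝓡 n) p}
    (he : ∀ i j, g p (e i) (e j) = if i = j then 1 else 0) :
    covDerivTensor g (fun A B C q => cubicForm P N A B q (C q)) X Y Z W p
        - covDerivTensor g (fun A B C q => cubicForm P N A B q (C q)) Y X Z W p
      = (inner ℝ (dirDeriv Z P p) (dirDeriv Y P p) * inner ℝ (dirDeriv W N p) (dirDeriv X P p)
          + inner ℝ (dirDeriv Z P p) (dirDeriv Y N p) * inner ℝ (dirDeriv W N p) (dirDeriv X N p)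
          - inner ℝ (dirDeriv Z N p) (dirDeriv Y P p) * inner ℝ (dirDeriv W P p) (dirDeriv X P p)
          - inner ℝ (dirDeriv Z N p) (dirDeriv Y N p) * inner ℝ (dirDeriv W P p) (dirDeriv X N p))
        - (inner ℝ (dirDeriv Z P p) (dirDeriv X P p) * inner ℝ (dirDeriv W N p) (dirDeriv Y P p)
          + inner ℝ (dirDeriv Z P p) (dirDeriv X N p) * inner ℝ (dirDeriv W N p) (dirDeriv Y N p)
          - inner ℝ (dirDeriv Z N p) (dirDeriv X P p) * inner ℝ (dirDeriv W P p) (dirDeriv Y P p)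
          - inner ℝ (dirDeriv Z N p) (dirDeriv X N p)
            * inner ℝ (dirDeriv W P p) (dirDeriv Y N p)) := by
  have sP : ∀ {A}, IsSmoothField A → SmoothMap (n := n) (dirDeriv A P) :=
    fun hA => contMDiff_dirDeriv hA h.smooth
  have sN : ∀ {A}, IsSmoothField A → SmoothMap (n := n) (dirDeriv A N) :=
    fun hA => contMDiff_dirDeriv hA h.smooth_normal
  have hder : ∀ {A B : Π p : M, TangentSpace (𝓡 n) p}, IsSmoothField A → IsSmoothField B →
      fieldDeriv A (fun q => cubicForm P N B Z q (W q)) p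
        = inner ℝ (dirDeriv A (dirDeriv B (dirDeriv Z P)) p) (dirDeriv W N p)
          - inner ℝ (dirDeriv A (dirDeriv B (dirDeriv Z N)) p) (dirDeriv W P p)
          + (inner ℝ (dirDeriv B (dirDeriv Z P) p) (dirDeriv A (dirDeriv W N) p)
            - inner ℝ (dirDeriv B (dirDeriv Z N) p) (dirDeriv A (dirDeriv W P) p)) := by
    intro A B hA hB
    have h1 := mvfderiv_fun_sub (I := 𝓡 n)
      ((SmoothMap.inner (contMDiff_dirDeriv hB (sP hZ)) (sN hW)).mdifferentiableAt p)
      ((SmoothMap.inner (contMDiff_dirDeriv hB (sN hZ)) (sP hW)).mdifferentiableAt p)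
    have h2 := congrArg (fun l => l (A p)) h1
    simp only [sub_apply] at h2
    rw [mvfderiv_inner (contMDiff_dirDeriv hB (sP hZ)) (sN hW),
      mvfderiv_inner (contMDiff_dirDeriv hB (sN hZ)) (sP hW)] at h2
    refine Eq.trans h2 ?_
    unfold dirDeriv
    ring
  -- Since `∇_X Y - ∇_Y X = [X,Y]`, these two terms absorb all third derivatives coming from `hder`.
  have hbr : cubicForm P N (leviCivita g X Y) Z p (W p)
      - cubicForm P N (leviCivita g Y X) Z p (W p)
      = inner ℝ (dirDeriv X (dirDeriv Y (dirDeriv Z P)) p) (dirDeriv W N p)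
        - inner ℝ (dirDeriv X (dirDeriv Y (dirDeriv Z N)) p) (dirDeriv W P p)
        - (inner ℝ (dirDeriv Y (dirDeriv X (dirDeriv Z P)) p) (dirDeriv W N p)
        - inner ℝ (dirDeriv Y (dirDeriv X (dirDeriv Z N)) p) (dirDeriv W P p)) := by
    have hl : ∀ {c : M → V}, SmoothMap (n := n) c →
        dirDeriv (leviCivita g X Y) c p - dirDeriv (leviCivita g Y X) c p
          = dirDeriv X (dirDeriv Y c) p - dirDeriv Y (dirDeriv X c) p := by
      intro c hc
      rw [← dirDeriv_mlieBracket hX hY hc]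
      unfold dirDeriv
      rw [← map_sub, h.leviCivita_sub_leviCivita hg hX hY]
    have h1 := congrArg (fun v => inner ℝ v (dirDeriv W N p)) (hl (sP hZ))
    have h2 := congrArg (fun v => inner ℝ v (dirDeriv W P p)) (hl (sN hZ))
    simp only [inner_sub_left] at h1 h2
    unfold cubicForm
    unfold dirDeriv at h1 h2 ⊢
    linarith
  have s1 := h.symplectic_secondDeriv_eq hV hg hY hZ hX hW he
  have s2 := h.symplectic_secondDeriv_eq hV hg hX hZ hY hW he
  -- The connection terms of `s1` and `s2` have the covariant derivative in the last slot; the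
  -- symmetry moves it there in the middle-slot terms as well.
  have c1 := h.cubicForm_comm (h.isSmoothField_leviCivita hg hX hZ) hW Y p
  have c2 := h.cubicForm_comm (h.isSmoothField_leviCivita hg hY hZ) hW X p
  unfold covDerivTensor
  rw [hder hX hY, hder hY hX]
  linarith

end IsLegendrePair

end LagrangianEquations

/-! ### Invariance under passing to parallel hypersurfaces. -/

section Rotation

variable {n : ℕ} {M : Type*} [TopologicalSpace M] [ChartedSpace (EuclideanSpace ℝ (Fin n)) M]
  {V : Type*} [NormedAddCommGroup V] [InnerProductSpace ℝ V] {P N : M → V}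

theorem SmoothMap.linearCombination (hP : SmoothMap (n := n) P) (hN : SmoothMap (n := n) N)
    (a b : ℝ) : SmoothMap (n := n) (fun q => a • P q + b • N q) :=
  (a • ContinuousLinearMap.fst ℝ V V + b • ContinuousLinearMap.snd ℝ V V).contDiff.contMDiff.comp
    (hP.prodMk_space hN)

theorem mvfderiv_linearCombination (hP : SmoothMap (n := n) P) (hN : SmoothMap (n := n) N)
    (a b : ℝ) (p : M) (u : TangentSpace (𝓡 n) p) :
    mvfderiv (𝓡 n) (fun q => a • P q + b • N q) p u
      = a • mvfderiv (𝓡 n) P p u + b • mvfderiv (𝓡 n) N p u := by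
  have h := mvfderiv_clm_comp (hP.prodMk_space hN)
    (a • ContinuousLinearMap.fst ℝ V V + b • ContinuousLinearMap.snd ℝ V V) p u
  rw [mvfderiv_prodMk hP hN] at h
  exact h

theorem dirDeriv_linearCombination (hP : SmoothMap (n := n) P) (hN : SmoothMap (n := n) N)
    (a b : ℝ) (X : Π p : M, TangentSpace (𝓡 n) p) :
    dirDeriv X (fun q => a • P q + b • N q) = fun q => a • dirDeriv X P q + b • dirDeriv X N q :=
  funext fun q => mvfderiv_linearCombination hP hN a b q (X q)

theorem IsLegendrePair.rotate (h : IsLegendrePair (n := n) P N) {a b : ℝ}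
    (hab : a * a + b * b = 1)
    (hi : ∀ p, Function.Injective (mvfderiv (𝓡 n) (fun q => a • P q + b • N q) p)) :
    IsLegendrePair (n := n) (fun q => a • P q + b • N q) (fun q => -b • P q + a • N q) where
  smooth := h.smooth.linearCombination h.smooth_normal a b
  injective := hi
  smooth_normal := h.smooth.linearCombination h.smooth_normal (-b) a
  inner_self p := by
    simp only [inner_add_left, inner_add_right, real_inner_smul_left, real_inner_smul_right,
      h.inner_self, h.inner_normal_self, h.inner_normal, real_inner_comm (P p) (N p)]
    linarith
  inner_normal_self p := by
    simp only [inner_add_left, inner_add_right, real_inner_smul_left, real_inner_smul_right,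
      h.inner_self, h.inner_normal_self, h.inner_normal, real_inner_comm (P p) (N p)]
    linarith
  inner_normal p := by
    simp only [inner_add_left, inner_add_right, real_inner_smul_left, real_inner_smul_right,
      h.inner_self, h.inner_normal_self, h.inner_normal, real_inner_comm (P p) (N p)]
    ring
  inner_deriv_normal p u := by
    rw [mvfderiv_linearCombination h.smooth h.smooth_normal]
    simp only [inner_add_left, inner_add_right, real_inner_smul_left, real_inner_smul_right,
      h.inner_deriv_self, h.inner_deriv_normal, h.inner_normalDeriv_self,
      h.inner_normalDeriv_normal, mul_zero, add_zero]

variable [IsManifold (𝓡 n) ∞ M]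

/-- The rotation multiplies `P + iN` by the unit complex number `a - ib`, and the symplectic form is
invariant under it. This is why `α` does not depend on `t`. -/
theorem IsLegendrePair.cubicForm_rotate (h : IsLegendrePair (n := n) P N) {a b : ℝ}
    (hab : a * a + b * b = 1) {Y : Π p : M, TangentSpace (𝓡 n) p} (hY : IsSmoothField Y)
    (X : Π p : M, TangentSpace (𝓡 n) p) (p : M) (z : TangentSpace (𝓡 n) p) :
    cubicForm (fun q => a • P q + b • N q) (fun q => -b • P q + a • N q) X Y p z
      = cubicForm P N X Y p z := by
  have hP := contMDiff_dirDeriv hY h.smooth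
  have hN := contMDiff_dirDeriv hY h.smooth_normal
  unfold cubicForm
  simp only [dirDeriv_linearCombination h.smooth h.smooth_normal, dirDeriv_linearCombination hP hN,
    mvfderiv_linearCombination h.smooth h.smooth_normal, inner_add_left, inner_add_right,
    real_inner_smul_left, real_inner_smul_right]
  linear_combination hab * (inner ℝ (dirDeriv X (dirDeriv Y P) p) (mvfderiv (𝓡 n) N p z)
    - inner ℝ (dirDeriv X (dirDeriv Y N) p) (mvfderiv (𝓡 n) P p z))

end Rotation

/-! ### The shape operator and its covariant derivative. -/

section Shape

variable {n : ℕ} {M : Type*} [TopologicalSpace M] [ChartedSpace (EuclideanSpace ℝ (Fin n)) M]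
  {P N : M → EuclideanSpace ℝ (Fin (n + 2))}

/-- One inclusion is orthogonality; equality follows from the dimension count `n = (n + 2) - 2`. -/
theorem IsLegendrePair.range_mvfderiv (h : IsLegendrePair (n := n) P N) (p : M) :
    LinearMap.range (mvfderiv (𝓡 n) P p).toLinearMap
      = (Submodule.span ℝ (Set.range ![P p, N p]))ᗮ := by
  have hon : Orthonormal ℝ ![P p, N p] := by
    rw [orthonormal_iff_ite]
    intro i j
    fin_cases i <;> fin_cases j <;>
      simp [-inner_self_eq_norm_sq_to_K, h.inner_self, h.inner_normal_self, h.inner_normal,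
        real_inner_comm (P p) (N p)]
  have hle : LinearMap.range (mvfderiv (𝓡 n) P p).toLinearMap
      ≤ (Submodule.span ℝ (Set.range ![P p, N p]))ᗮ := by
    rintro _ ⟨u, rfl⟩
    rw [Submodule.mem_orthogonal']
    intro v hv
    induction hv using Submodule.span_induction with
    | mem x hx =>
      obtain ⟨i, rfl⟩ := hx
      fin_cases i
      · exact h.inner_deriv_self p u
      · exact h.inner_deriv_normal p u
    | zero => exact inner_zero_right _
    | add x y _ _ hx hy => rw [inner_add_right, hx, hy, add_zero]
    | smul a x _ hx => rw [real_inner_smul_right, hx, mul_zero]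
  refine Submodule.eq_of_le_of_finrank_eq hle ?_
  have h1 := Submodule.finrank_add_finrank_orthogonal (Submodule.span ℝ (Set.range ![P p, N p]))
  rw [finrank_span_eq_card hon.linearIndependent, finrank_euclideanSpace_fin, Fintype.card_fin] at h1
  have h2 : Module.finrank ℝ (LinearMap.range (mvfderiv (𝓡 n) P p).toLinearMap) = n :=
    (LinearMap.finrank_range_of_inj (h.injective p)).trans finrank_euclideanSpace_fin
  omega

/-- `dN` is orthogonal to `P` and `N`, hence factors through the injective map `dP`; so the default
value in `shapeOperator` does not occur. -/
theorem IsLegendrePair.shapeOperator_spec (h : IsLegendrePair (n := n) P N) (p : M)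
    (u : TangentSpace (𝓡 n) p) :
    mvfderiv (𝓡 n) N p u = -mvfderiv (𝓡 n) P p (shapeOperator P N p u) := by
  have hmem : ∀ v, (-(mvfderiv (𝓡 n) N p)).toLinearMap v
      ∈ LinearMap.range (mvfderiv (𝓡 n) P p).toLinearMap := by
    intro v
    rw [h.range_mvfderiv, Submodule.mem_orthogonal']
    intro w hw
    induction hw using Submodule.span_induction with
    | mem x hx =>
      obtain ⟨i, rfl⟩ := hx
      fin_cases i
      · exact (inner_neg_left _ _).trans (neg_eq_zero.2 (h.inner_normalDeriv_self p v))
      · exact (inner_neg_left _ _).trans (neg_eq_zero.2 (h.inner_normalDeriv_normal p v))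
    | zero => exact inner_zero_right _
    | add x y _ _ hx hy => rw [inner_add_right, hx, hy, add_zero]
    | smul a x _ hx => rw [real_inner_smul_right, hx, mul_zero]
  have hex : ∃ A : Module.End ℝ (TangentSpace (𝓡 n) p),
      ∀ u, mvfderiv (𝓡 n) N p u = -mvfderiv (𝓡 n) P p (A u) := by
    let e := LinearEquiv.ofInjective (mvfderiv (𝓡 n) P p).toLinearMap (h.injective p)
    refine ⟨e.symm.toLinearMap ∘ₗ LinearMap.codRestrict _ _ hmem, fun v => ?_⟩
    have h1 := congrArg Subtype.val (e.apply_symm_apply (LinearMap.codRestrict _ _ hmem v))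
    have h2 : mvfderiv (𝓡 n) P p (e.symm (LinearMap.codRestrict _ _ hmem v))
      = -mvfderiv (𝓡 n) N p v := h1
    exact (neg_eq_iff_eq_neg.2 h2).symm
  rw [shapeOperator, dif_pos hex]
  exact hex.choose_spec u

variable [IsManifold (𝓡 n) ∞ M]

theorem IsLegendrePair.isSmoothField_shapeOperator (h : IsLegendrePair (n := n) P N)
    {Y : Π p : M, TangentSpace (𝓡 n) p} (hY : IsSmoothField Y) :
    IsSmoothField (fun q => shapeOperator P N q (Y q)) := by
  refine h.isSmoothField (c := fun q => -dirDeriv Y N q)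
    (contMDiff_dirDeriv hY h.smooth_normal).neg fun p z => ?_
  unfold dirDeriv
  rw [h.shapeOperator_spec p (Y p), neg_neg]

/-- Since `dP(AY) = -D_Y N`, the first term is `-⟨D_X D_Y N, dP z⟩`. Moving the symmetric operator
`A` onto `z` turns the second into `-⟨D_X D_Y P, dN z⟩`. -/
theorem IsLegendrePair.metric_covDeriv_shapeOperator (h : IsLegendrePair (n := n) P N)
    {X Y : Π p : M, TangentSpace (𝓡 n) p} (hX : IsSmoothField X) (hY : IsSmoothField Y) (p : M)
    (z : TangentSpace (𝓡 n) p) :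
    inducedMetric P p
      (leviCivita (inducedMetric P) X (fun q => shapeOperator P N q (Y q)) p
        - shapeOperator P N p (leviCivita (inducedMetric P) X Y p)) z
      = cubicForm P N X Y p z := by
  have hg : ∀ p u v, inducedMetric P p u v
      = inner ℝ (mvfderiv (𝓡 n) P p u) (mvfderiv (𝓡 n) P p v) := fun _ _ _ => rfl
  -- The redundant zero summand puts `-D_Y N` in the shape required by `dirDeriv_linearCombination`.
  have hAY : dirDeriv (fun q => shapeOperator P N q (Y q)) P
      = fun q => (-1 : ℝ) • dirDeriv Y N q + (0 : ℝ) • dirDeriv Y N q := by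
    funext q
    unfold dirDeriv
    rw [h.shapeOperator_spec q (Y q)]
    simp
  have hDN := contMDiff_dirDeriv hY h.smooth_normal
  have h1 := h.isTangentialPart_leviCivita hg hX hY p (shapeOperator P N p z)
  rw [map_sub, LinearMap.sub_apply, hg, hg, h.isTangentialPart_leviCivita hg hX
    (h.isSmoothField_shapeOperator hY), hAY, dirDeriv_linearCombination hDN hDN, cubicForm]
  have h2 := h.inner_deriv_normalDeriv_comm p (leviCivita (inducedMetric P) X Y p) z
  rw [h.shapeOperator_spec p z, h.shapeOperator_spec p (leviCivita (inducedMetric P) X Y p),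
    inner_neg_right, inner_neg_left, neg_inj, h1] at h2
  rw [← h2, h.shapeOperator_spec p z]
  simp only [inner_add_left, real_inner_smul_left, inner_neg_right]
  ring

end Shape

/-! ### Algebra of the Cayley transform of the shape operator. -/

section Complexification

/-- Commuting factors of a unit are units. With `u = A + i`, `v = A - i` and `c = A² + 1`, this
clears the denominators of `B_0` and `B_0⁻¹`. -/
theorem mul_ringInverse_factor {R : Type*} [Ring R] {u v c : R} (hc : IsUnit c) (huv : u * v = c)
    (hvu : v * u = c) :
    c * (u * Ring.inverse v) = u * u ∧ c * Ring.inverse (u * Ring.inverse v) = v * v := by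
  obtain ⟨⟨u, rfl⟩, ⟨v, rfl⟩⟩ :=
    (Commute.isUnit_mul_iff (huv.trans hvu.symm)).1 (huv.symm ▸ hc)
  rw [Ring.inverse_unit, ← Units.val_mul, Ring.inverse_unit, mul_inv_rev, inv_inv]
  have key : ∀ a b : Rˣ, a * b = b * a → a * b * (a * b⁻¹) = a * a := fun a b hab => by
    rw [mul_assoc a b, ← mul_assoc b a, ← hab, mul_inv_cancel_right]
  have hcomm : u * v = v * u := Units.ext (huv.trans hvu.symm)
  constructor
  · rw [← huv, ← Units.val_mul, ← Units.val_mul, key u v hcomm, Units.val_mul]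
  · rw [← hvu, ← Units.val_mul, ← Units.val_mul, key v u hcomm.symm, Units.val_mul]

variable {T : Type*} [AddCommGroup T] [Module ℝ T] {A : Module.End ℝ T}
  {k g : LinearMap.BilinForm ℝ T}

theorem shifted_baseChange_mul :
    (A.baseChange ℂ + Complex.I • 1) * (A.baseChange ℂ - Complex.I • 1) = (A * A + 1).baseChange ℂ
    ∧ (A.baseChange ℂ - Complex.I • 1) * (A.baseChange ℂ + Complex.I • 1)
      = (A * A + 1).baseChange ℂ := by
  have h : (A * A + 1).baseChange ℂ = A.baseChange ℂ * A.baseChange ℂ + 1 := by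
    rw [LinearMap.baseChange_add, Module.End.mul_eq_comp, LinearMap.baseChange_comp]
    rw [Module.End.one_eq_id, LinearMap.baseChange_id]
    rfl
  rw [h]
  constructor <;>
  · simp only [add_mul, mul_add, sub_mul, mul_sub, smul_mul_assoc, mul_smul_comm, mul_one, one_mul]
    match_scalars <;> simp

theorem baseChange_apply_eq (hk : ∀ x y, k x y = 1 / 2 * g ((A * A + 1) x) y) (ξ : ℂ ⊗[ℝ] T)
    (y : T) :
    k.baseChange ℂ ξ (1 ⊗ₜ y) = 1 / 2 * g.baseChange ℂ ((A * A + 1).baseChange ℂ ξ) (1 ⊗ₜ y) := by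
  induction ξ using TensorProduct.induction_on with
  | zero => simp
  | add ξ η h1 h2 => simp only [map_add, LinearMap.add_apply, h1, h2]; ring
  | tmul a x =>
    rw [LinearMap.baseChange_tmul, LinearMap.BilinForm.baseChange_tmul,
      LinearMap.BilinForm.baseChange_tmul, hk]
    simp
    ring

theorem baseChange_shifted_sq (g : LinearMap.BilinForm ℝ T) (A : Module.End ℝ T) (s : ℂ)
    (x y : T) :
    g.baseChange ℂ (((A.baseChange ℂ + s • 1) * (A.baseChange ℂ + s • 1)) (1 ⊗ₜ x)) (1 ⊗ₜ y)
      = g (A (A x)) y + 2 * s * g (A x) y + s * s * g x y := by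
  simp only [Module.End.mul_apply, LinearMap.add_apply, LinearMap.smul_apply, Module.End.one_apply,
    map_add, map_smul, LinearMap.baseChange_tmul, LinearMap.BilinForm.baseChange_tmul,
    mul_one, Complex.real_smul, smul_eq_mul]
  ring

end Complexification

/-! ### The isoparametric data as a Legendre pair. -/

section Hypersurface

variable {n : ℕ} {M : Type*} {F : M → Metric.sphere (0 : EuclideanSpace ℝ (Fin (n + 2))) 1}
  {ν : M → EuclideanSpace ℝ (Fin (n + 2))}

/-- A map into the sphere, regarded as a map into the ambient Euclidean space. -/
def ambient (F : M → Metric.sphere (0 : EuclideanSpace ℝ (Fin (n + 2))) 1) (p : M) :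
    EuclideanSpace ℝ (Fin (n + 2)) :=
  F p

theorem parallel_zero : parallel F ν 0 = ambient F := by
  funext p
  simp [parallel, ambient]

theorem parallelNormal_zero : parallelNormal F ν 0 = ν := by
  funext p
  simp [parallelNormal]

variable [TopologicalSpace M] [ChartedSpace (EuclideanSpace ℝ (Fin n)) M]

theorem IsIsoparametric.isLegendrePair (hF : IsIsoparametric F ν) :
    IsLegendrePair (n := n) (ambient F) ν := by
  have : Fact (Module.finrank ℝ (EuclideanSpace ℝ (Fin (n + 2))) = n + 1 + 1) :=
    ⟨finrank_euclideanSpace_fin⟩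
  have hcoe : ContMDiff (𝓡 (n + 1)) 𝓘(ℝ, EuclideanSpace ℝ (Fin (n + 2))) ∞
      ((↑) : Metric.sphere (0 : EuclideanSpace ℝ (Fin (n + 2))) 1 →
        EuclideanSpace ℝ (Fin (n + 2))) := contMDiff_coe_sphere
  refine ⟨⟨hcoe.comp hF.smooth, fun p => ?_⟩, hF.normal_smooth, fun p => ?_, fun p => ?_,
    hF.normal_tangent, hF.normal_orthogonal⟩
  · have h1 : mvfderiv (𝓡 n) (ambient F) p = (mvfderiv (𝓡 (n + 1))
        ((↑) : Metric.sphere (0 : EuclideanSpace ℝ (Fin (n + 2))) 1 →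
        EuclideanSpace ℝ (Fin (n + 2))) (F p)).comp
          (mfderiv (𝓡 n) (𝓡 (n + 1)) F p) :=
      mfderiv_comp p ((hcoe (F p)).mdifferentiableAt (by simp))
        ((hF.smooth p).mdifferentiableAt (by simp))
    rw [h1]
    exact (injective_mvfderiv_subtypeVal_sphere (F p)).comp (hF.immersion p)
  · rw [real_inner_self_eq_norm_sq, ambient, norm_eq_of_mem_sphere, one_pow]
  · rw [real_inner_self_eq_norm_sq, hF.normal_unit, one_pow]

/-- The real-linear map `(x, y) ↦ (x + i y) / √2`. -/
def complexify (m : ℕ) : EuclideanSpace ℝ (Fin m) × EuclideanSpace ℝ (Fin m) →ₗ[ℝ]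
    EuclideanSpace ℂ (Fin m) where
  toFun x := WithLp.toLp 2 fun k =>
    ((1 / Real.sqrt 2 : ℝ) : ℂ) * ((x.1 k : ℂ) + Complex.I * (x.2 k : ℂ))
  map_add' x y := by
    ext k
    simp
    ring
  map_smul' a x := by
    ext k
    simp
    ring

theorem re_inner_complexify {m : ℕ} (x y z w : EuclideanSpace ℝ (Fin m)) :
    (inner ℂ (complexify m (x, y)) (complexify m (z, w))).re
      = 1 / 2 * (inner ℝ x z + inner ℝ y w) := by
  rw [PiLp.inner_apply, PiLp.inner_apply, PiLp.inner_apply, ← Finset.sum_add_distrib,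
    Finset.mul_sum, Complex.re_sum]
  refine Finset.sum_congr rfl fun k _ => ?_
  simp [complexify]
  linear_combination (z.ofLp k * x.ofLp k + w.ofLp k * y.ofLp k) / 4 *
    Real.mul_self_sqrt (show (0 : ℝ) ≤ 2 by norm_num)

theorem isPairMetric_lagrangianMetric (hF : IsIsoparametric F ν) :
    IsPairMetric (ambient F) ν (lagrangianMetric F ν) := by
  have h := hF.isLegendrePair
  have hl : ∀ p u, mvfderiv (𝓡 n) (lift F ν 0) p u
      = complexify (n + 2) (mvfderiv (𝓡 n) (ambient F) p u, mvfderiv (𝓡 n) ν p u) := by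
    intro p u
    have h1 : lift F ν 0 = fun q => (complexify (n + 2)).toContinuousLinearMap (ambient F q, ν q) := by
      funext q
      rw [lift, parallel_zero, parallelNormal_zero]
      rfl
    rw [h1, ← mvfderiv_prodMk h.smooth h.smooth_normal]
    exact mvfderiv_clm_comp (h.smooth.prodMk_space h.smooth_normal) _ p u
  intro p u v
  rw [← re_inner_complexify, ← hl, ← hl]
  rfl

/-- The frame returned is the one `metricTrace` itself selects, so independence of the trace from
the frame is not needed. Existence comes from an orthonormal basis of the image of the differential
of the doubled immersion. -/
theorem exists_orthonormal_metricTrace_eq (hF : IsIsoparametric F ν) (p : M) :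
    ∃ e : Fin n → TangentSpace (𝓡 n) p,
      (∀ i j, lagrangianMetric F ν p (e i) (e j) = if i = j then 1 else 0) ∧
      ∀ β : TangentSpace (𝓡 n) p → TangentSpace (𝓡 n) p → ℝ,
        metricTrace n (fun u v => lagrangianMetric F ν p u v) β = ∑ i, β (e i) (e i) := by
  have h := hF.isLegendrePair
  have hex : ∃ e : Fin n → TangentSpace (𝓡 n) p,
      ∀ i j, (fun u v => lagrangianMetric F ν p u v) (e i) (e j) = if i = j then 1 else 0 := by
    let D := (mvfderiv (𝓡 n) (fun q => doubling (ambient F q, ν q)) p).toLinearMap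
    have hfr : Module.finrank ℝ (LinearMap.range D) = n :=
      (LinearMap.finrank_range_of_inj (h.isSmoothImmersion_doubling.injective p)).trans
        finrank_euclideanSpace_fin
    let b := (stdOrthonormalBasis ℝ (LinearMap.range D)).reindex (finCongr hfr)
    choose e he using fun i => (b i).2
    refine ⟨e, fun i j => ?_⟩
    have h1 := orthonormal_iff_ite.1 b.orthonormal i j
    rw [Submodule.coe_inner, ← he, ← he] at h1
    exact (h.metric_eq_inner_doubling (isPairMetric_lagrangianMetric hF) p _ _).trans h1
  refine ⟨hex.choose, hex.choose_spec, fun β => ?_⟩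
  rw [metricTrace, dif_pos hex]

variable [IsManifold (𝓡 n) ∞ M]

theorem alphaForm_eq_cubicForm (hF : IsIsoparametric F ν) {t : ℝ} (ht : IsRegular F ν t)
    {X Y : Π p : M, TangentSpace (𝓡 n) p} (hX : IsSmoothField X) (hY : IsSmoothField Y) (p : M)
    (z : TangentSpace (𝓡 n) p) :
    alphaForm F ν t X Y p z = cubicForm (ambient F) ν X Y p z := by
  have hrot : Real.cos t * Real.cos t + Real.sin t * Real.sin t = 1 := by
    rw [← Real.cos_sq_add_sin_sq t]; ring
  exact ((hF.isLegendrePair.rotate hrot ht).metric_covDeriv_shapeOperator hX hY p z).trans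
    (hF.isLegendrePair.cubicForm_rotate hrot hY X p z)

/-- The factor `A² + 1` in `ĝ = ½ g((A² + 1)·,·)` cancels the denominator, so `b` and `b̄` become `½
g((A ± i)²·,·)`. Then `g(A·,·) = -⟨dν, dF⟩` and `g(A²·,·) = ⟨dν, dν⟩`. -/
theorem formB_formBbar_eq (hF : IsIsoparametric F ν) (p : M) (x y : TangentSpace (𝓡 n) p) :
    formB F ν p x y
      = ((1 / 2 * (inner ℝ (mvfderiv (𝓡 n) ν p x) (mvfderiv (𝓡 n) ν p y)
          - inner ℝ (mvfderiv (𝓡 n) (ambient F) p x) (mvfderiv (𝓡 n) (ambient F) p y)) : ℝ) : ℂ)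
        - Complex.I * (inner ℝ (mvfderiv (𝓡 n) ν p x) (mvfderiv (𝓡 n) (ambient F) p y) : ℝ) ∧
    formBbar F ν p x y
      = ((1 / 2 * (inner ℝ (mvfderiv (𝓡 n) ν p x) (mvfderiv (𝓡 n) ν p y)
          - inner ℝ (mvfderiv (𝓡 n) (ambient F) p x) (mvfderiv (𝓡 n) (ambient F) p y)) : ℝ) : ℂ)
        + Complex.I * (inner ℝ (mvfderiv (𝓡 n) ν p x) (mvfderiv (𝓡 n) (ambient F) p y) : ℝ) := by
  have h := hF.isLegendrePair
  let A : Module.End ℝ (TangentSpace (𝓡 n) p) := shapeOperator (ambient F) ν p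
  let g := inducedMetric (ambient F) p
  have hA : parallelShape F ν 0 p = A := by
    rw [parallelShape, parallel_zero, parallelNormal_zero]
  have hg1 : ∀ u v, g (A u) v
      = -inner ℝ (mvfderiv (𝓡 n) ν p u) (mvfderiv (𝓡 n) (ambient F) p v) := by
    intro u v
    rw [h.shapeOperator_spec p u, inner_neg_left, neg_neg]
    rfl
  have hg2 : ∀ u v, g (A (A u)) v
      = inner ℝ (mvfderiv (𝓡 n) ν p u) (mvfderiv (𝓡 n) ν p v) := by
    intro u v
    rw [hg1, ← h.inner_deriv_normalDeriv_comm, h.shapeOperator_spec p u, inner_neg_left]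
  have hk : ∀ u v, lagrangianMetric F ν p u v = 1 / 2 * g ((A * A + 1) u) v := by
    intro u v
    rw [isPairMetric_lagrangianMetric hF p u v, LinearMap.add_apply, Module.End.mul_apply,
      Module.End.one_apply, map_add, LinearMap.add_apply, hg2, add_comm]
    rfl
  -- A kernel vector of `A² + 1` would be `ĝ`-null, and `ĝ` is positive definite.
  have hunit : IsUnit (A * A + 1) := by
    have : FiniteDimensional ℝ (TangentSpace (𝓡 n) p) :=
      inferInstanceAs (FiniteDimensional ℝ (EuclideanSpace ℝ (Fin n)))
    rw [LinearMap.isUnit_iff_ker_eq_bot, LinearMap.ker_eq_bot']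
    intro u hu
    have h1 := hk u u
    rw [hu, map_zero, LinearMap.zero_apply, mul_zero,
      h.metric_eq_inner_doubling (isPairMetric_lagrangianMetric hF), inner_self_eq_zero] at h1
    exact h.isSmoothImmersion_doubling.injective p (h1.trans (map_zero _).symm)
  have hunit' : IsUnit ((A * A + 1).baseChange ℂ) :=
    hunit.map (Module.End.baseChangeHom ℝ ℂ (TangentSpace (𝓡 n) p))
  obtain ⟨h1, h2⟩ := shifted_baseChange_mul (A := A)
  obtain ⟨h3, h4⟩ := mul_ringInverse_factor hunit' h1 h2
  have hsq : ∀ s : ℂ, s * s = -1 → 1 / 2 * g.baseChange ℂ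
      (((A.baseChange ℂ + s • 1) * (A.baseChange ℂ + s • 1)) (1 ⊗ₜ x)) (1 ⊗ₜ y)
      = ((1 / 2 * (inner ℝ (mvfderiv (𝓡 n) ν p x) (mvfderiv (𝓡 n) ν p y)
          - inner ℝ (mvfderiv (𝓡 n) (ambient F) p x) (mvfderiv (𝓡 n) (ambient F) p y)) : ℝ) : ℂ)
        - s * (inner ℝ (mvfderiv (𝓡 n) ν p x) (mvfderiv (𝓡 n) (ambient F) p y) : ℝ) := by
    intro s hs
    rw [baseChange_shifted_sq, hs, hg2, hg1]
    change 1 / 2 * (_ + _ + -1 * ((inner ℝ (mvfderiv (𝓡 n) (ambient F) p x)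
      (mvfderiv (𝓡 n) (ambient F) p y) : ℝ) : ℂ)) = _
    push_cast
    ring
  constructor
  · rw [formB, opB, hA, baseChange_apply_eq hk, ← Module.End.mul_apply, h3]
    exact hsq Complex.I Complex.I_mul_I
  · rw [formBbar, opB, hA, baseChange_apply_eq hk, ← Module.End.mul_apply, h4]
    have h5 := hsq (-Complex.I) (by rw [neg_mul_neg, Complex.I_mul_I])
    have h6 : A.baseChange ℂ - Complex.I • 1 = A.baseChange ℂ + (-Complex.I) • 1 :=
      LinearMap.ext fun ξ => by simp [sub_eq_add_neg]
    rw [h6, h5]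
    ring

end Hypersurface

/-! ### The Codazzi and Gauss equations. -/

section Equations

variable {n : ℕ} {M : Type*} [TopologicalSpace M] [ChartedSpace (EuclideanSpace ℝ (Fin n)) M]
  [IsManifold (𝓡 n) ∞ M] {F : M → Metric.sphere (0 : EuclideanSpace ℝ (Fin (n + 2))) 1}
  {ν : M → EuclideanSpace ℝ (Fin (n + 2))} {t : ℝ} {X Y Z W : Π p : M, TangentSpace (𝓡 n) p}

/-- `α` is identified with the cubic form only when its first two arguments are smooth fields, so
smoothness of the covariant derivatives enters here. -/
theorem covDerivTensor_alpha (hF : IsIsoparametric F ν) (ht : IsRegular F ν t)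
    (hX : IsSmoothField X) (hY : IsSmoothField Y) (hZ : IsSmoothField Z) (p : M) :
    covDerivTensor (lagrangianMetric F ν) (alpha F ν t) X Y Z W p
      = covDerivTensor (lagrangianMetric F ν)
          (fun A B C q => cubicForm (ambient F) ν A B q (C q)) X Y Z W p := by
  have hα : ∀ {A B C : Π p : M, TangentSpace (𝓡 n) p}, IsSmoothField A → IsSmoothField B →
      alpha F ν t A B C = fun q => cubicForm (ambient F) ν A B q (C q) :=
    fun hA hB => funext fun q => alphaForm_eq_cubicForm hF ht hA hB q _
  have hLC : ∀ {A B : Π p : M, TangentSpace (𝓡 n) p}, IsSmoothField A → IsSmoothField B →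
      IsSmoothField (leviCivita (lagrangianMetric F ν) A B) := fun hA hB =>
    hF.isLegendrePair.isSmoothField_leviCivita (isPairMetric_lagrangianMetric hF) hA hB
  unfold covDerivTensor
  rw [hα hY hZ, hα (hLC hX hY) hZ, hα hY (hLC hX hZ), hα hY hZ]

/-- The Codazzi equation. -/
theorem codazzi (hF : IsIsoparametric F ν) (ht : IsRegular F ν t)
    (hX : IsSmoothField X) (hY : IsSmoothField Y) (hZ : IsSmoothField Z) (hW : IsSmoothField W)
    (p : M) :
    covDerivTensor (lagrangianMetric F ν) (alpha F ν t) X Y Z W p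
        - covDerivTensor (lagrangianMetric F ν) (alpha F ν t) Y X Z W p
      = 2 * (tensorT F ν p (X p) (Z p) (Y p) (W p) + tensorT F ν p (X p) (W p) (Y p) (Z p)) := by
  have h := hF.isLegendrePair
  obtain ⟨e, he, -⟩ := exists_orthonormal_metricTrace_eq hF p
  rw [covDerivTensor_alpha hF ht hX hY hZ, covDerivTensor_alpha hF ht hY hX hZ,
    h.covDerivTensor_cubicForm_sub finrank_euclideanSpace_fin (isPairMetric_lagrangianMetric hF)
      hX hY hZ hW he]
  have cP := fun A B : Π p : M, TangentSpace (𝓡 n) p =>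
    real_inner_comm (dirDeriv A (ambient F) p) (dirDeriv B (ambient F) p)
  have cN := fun A B : Π p : M, TangentSpace (𝓡 n) p =>
    real_inner_comm (dirDeriv A ν p) (dirDeriv B ν p)
  have cPN := fun A B : Π p : M, TangentSpace (𝓡 n) p =>
    real_inner_comm (dirDeriv A ν p) (dirDeriv B (ambient F) p)
  -- Symmetry of the second fundamental form lets every mixed product be brought to one ordering, so
  -- that the rest is a polynomial identity.
  have cNP : ∀ A B : Π p : M, TangentSpace (𝓡 n) p,
      inner ℝ (dirDeriv B ν p) (dirDeriv A (ambient F) p)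
        = inner ℝ (dirDeriv A ν p) (dirDeriv B (ambient F) p) := fun A B => by
    rw [← cPN]
    exact (h.inner_deriv_normalDeriv_comm p (A p) (B p))
  simp only [tensorT, (formB_formBbar_eq hF p _ _).1, (formB_formBbar_eq hF p _ _).2,
    Complex.mul_im, Complex.add_im, Complex.add_re, Complex.sub_im, Complex.sub_re, Complex.mul_re,
    Complex.ofReal_re, Complex.ofReal_im, Complex.I_re, Complex.I_im]
  simp only [cPN, cP X Z, cP X W, cP Y Z, cP Y W, cN X Z, cN X W, cN Y Z, cN Y W,
    cNP X Z, cNP X W, cNP Y Z, cNP Y W]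
  unfold dirDeriv
  ring

/-- The Gauss equation. -/
theorem gauss (hF : IsIsoparametric F ν) (ht : IsRegular F ν t)
    (hX : IsSmoothField X) (hY : IsSmoothField Y) (hZ : IsSmoothField Z) (hW : IsSmoothField W)
    (p : M) :
    (riemann (lagrangianMetric F ν) X Y Z W p : ℂ)
      = kulkarniNomizu (fun u v => (lagrangianMetric F ν p u v : ℂ))
            (fun u v => (lagrangianMetric F ν p u v : ℂ)) (X p) (Y p) (Z p) (W p)
        + kulkarniNomizu (formB F ν p) (formBbar F ν p) (X p) (Y p) (Z p) (W p)
        + (1 / 4) * (alphaKulkarniNomizu F ν t X Y Z W p : ℂ) := by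
  have h := hF.isLegendrePair
  have hg := isPairMetric_lagrangianMetric hF
  obtain ⟨e, he, htr⟩ := exists_orthonormal_metricTrace_eq hF p
  have cP := fun A B : Π p : M, TangentSpace (𝓡 n) p =>
    real_inner_comm (dirDeriv A (ambient F) p) (dirDeriv B (ambient F) p)
  have cN := fun A B : Π p : M, TangentSpace (𝓡 n) p =>
    real_inner_comm (dirDeriv A ν p) (dirDeriv B ν p)
  have cPN := fun A B : Π p : M, TangentSpace (𝓡 n) p =>
    real_inner_comm (dirDeriv A ν p) (dirDeriv B (ambient F) p)
  have cNP : ∀ A B : Π p : M, TangentSpace (𝓡 n) p,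
      inner ℝ (dirDeriv B ν p) (dirDeriv A (ambient F) p)
        = inner ℝ (dirDeriv A ν p) (dirDeriv B (ambient F) p) := fun A B => by
    rw [← cPN]
    exact (h.inner_deriv_normalDeriv_comm p (A p) (B p))
  rw [alphaKulkarniNomizu, htr, h.riemann_eq finrank_euclideanSpace_fin hg hX hY hZ hW he]
  simp only [alphaForm_eq_cubicForm hF ht hX hW, alphaForm_eq_cubicForm hF ht hY hZ,
    alphaForm_eq_cubicForm hF ht hX hZ, alphaForm_eq_cubicForm hF ht hY hW]
  -- With `b = β - iγ` and `b̄ = β + iγ`, the symmetrised products in `b ⊙ b̄` are real and equal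
  -- `ββ' + γγ'`. Adding `ĝĝ'` leaves `½(⟨dF,dF⟩⟨dF,dF⟩' + ⟨dν,dν⟩⟨dν,dν⟩') + γγ'`, the contribution
  -- of the four extra directions.
  simp only [cPN, cP X Z, cP X W, cP Y Z, cP Y W, cN X Z, cN X W, cN Y Z, cN Y W,
    cNP X Z, cNP X W, cNP Y Z, cNP Y W, kulkarniNomizu, (formB_formBbar_eq hF p _ _).1,
    (formB_formBbar_eq hF p _ _).2, hg p]
  unfold dirDeriv
  push_cast
  ring_nf
  simp only [Complex.I_sq]
  ring

end Equations

end Isoparametric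

end

theorem mainTheorem4 {n : ℕ} {M : Type*} [TopologicalSpace M]
    [ChartedSpace (EuclideanSpace ℝ (Fin n)) M] [IsManifold (𝓡 n) ∞ M] [ConnectedSpace M]
    (F : M → Metric.sphere (0 : EuclideanSpace ℝ (Fin (n + 2))) 1)
    (ν : M → EuclideanSpace ℝ (Fin (n + 2)))
    (hF : Isoparametric.IsIsoparametric F ν)
    (t : ℝ) (ht : Isoparametric.IsRegular F ν t)
    (X Y Z W : Π p : M, TangentSpace (𝓡 n) p)
    (hX : Isoparametric.IsSmoothField X) (hY : Isoparametric.IsSmoothField Y)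
    (hZ : Isoparametric.IsSmoothField Z) (hW : Isoparametric.IsSmoothField W) (p : M) :
    (Isoparametric.covDerivTensor (Isoparametric.lagrangianMetric F ν)
          (Isoparametric.alpha F ν t) X Y Z W p
        - Isoparametric.covDerivTensor (Isoparametric.lagrangianMetric F ν)
          (Isoparametric.alpha F ν t) Y X Z W p
      = 2 * (Isoparametric.tensorT F ν p (X p) (Z p) (Y p) (W p)
          + Isoparametric.tensorT F ν p (X p) (W p) (Y p) (Z p))) ∧
    ((Isoparametric.riemann (Isoparametric.lagrangianMetric F ν) X Y Z W p : ℂ)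
      = Isoparametric.kulkarniNomizu
            (fun u v => (Isoparametric.lagrangianMetric F ν p u v : ℂ))
            (fun u v => (Isoparametric.lagrangianMetric F ν p u v : ℂ)) (X p) (Y p) (Z p) (W p)
        + Isoparametric.kulkarniNomizu (Isoparametric.formB F ν p) (Isoparametric.formBbar F ν p)
            (X p) (Y p) (Z p) (W p)
        + (1 / 4) * (Isoparametric.alphaKulkarniNomizu F ν t X Y Z W p : ℂ)) := by
  exact ⟨Isoparametric.codazzi hF ht hX hY hZ hW p, Isoparametric.gauss hF ht hX hY hZ hW p⟩
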